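/- **Conventions.** A (twisted unital discrete $C^*$-dynamical) *system* $\Sigma=(A,G,\alpha,\sigma)$ consists of a unital $C^*$-algebra $A$, a discrete group $G$ with identity $e$, and maps $\alpha:G\to\mathrm{Aut}(A)$, $\sigma:G\times G\to\mathcal U(A)$ with $$\alpha_g\alpha_h=\mathrm{Ad}(\sigma(g,h))\,\alpha_{gh},\qquad \sigma(g,h)\,\sigma(gh,k)=\alpha_g(\sigma(h,k))\,\sigma(g,hk),\qquad \sigma(g,e)=\sigma(e,g)=1_A .$$ Let $\Sigma=(A,G,\alpha,\sigma)$ and $\Theta=(B,G,\beta,\theta)$ be systems over the same group $G$. A *right Hilbert $A$-$B$-bimodule* is a right Hilbert $B$-module $Z$ with a unital $*$-homomorphism $A\to\mathcal L_B(Z)$ into the adjointable operators, written $a\cdot z$; an *isomorphism* of such bimodules is a bimodule isomorphism preserving the inner products. Let $\mathcal I(Z)$ be the group of bounded invertible $\mathbb C$-linear maps $Z\to Z$. A *$(\Sigma,\Theta)$-compatible action* on $Z$ is a map $\delta:G\to\mathcal I(Z)$ such that for all $g,h\in G$, $a\in A$, $b\in B$, $z,\zeta\in Z$ $$\delta(g)(a\cdot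 z)=\alpha_g(a)\cdot\delta(g)z,\qquad \delta(g)(z\cdot b)=(\delta(g)z)\cdot\beta_g(b),$$ $$\delta(g)\delta(h)z=\sigma(g,h)\cdot(\delta(gh)z)\cdot\theta(g,h)^*,\qquad \langle\delta(g)z,\delta(g)\zeta\rangle_B=\beta_g(\langle z,\zeta\rangle_B).$$ Two compatible actions $\delta$ on $Z$ and $\delta'$ on $Z'$ are *equivariantly isomorphic* if some isomorphism of right Hilbert $A$-$B$-bimodules $Z\to Z'$ intertwines $\delta$ and $\delta'$. If $\delta$ is a $(\Sigma,\Theta)$-compatible action on $X$ and $\eta$ a $(\Theta,\Omega)$-compatible action on $Y$, the *product action* $\delta\otimes_B\eta$ is the $(\Sigma,\Omega)$-compatible action on the internal tensor product $X\otimes_BY$ determined by $(\delta\otimes_B\eta)(g)(x\otimes y)=\delta(g)x\otimes\eta(g)y$. An *$A$-$B$ imprimitivity bimodule* is a full right Hilbert $A$-$B$-bimodule $Z$ that is also a full left Hilbert $A$-$B$-bimodule for an $A$-valued inner product ${}_A\langle\cdot,\cdot\rangle$ (on which $B$ acts on the right by adjointable operators), with ${}_A\langle z,z'\rangle\cdot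 z''=z\cdot\langle z',z''\rangle_B$ for all $z,z',z''\in Z$. The systems $\Sigma,\Theta$ are *Morita equivalent* via $(Z,\delta)$, written $\Sigma\sim_{(Z,\delta)}\Theta$, if $Z$ is an $A$-$B$ imprimitivity bimodule and $\delta$ is a $(\Sigma,\Theta)$-compatible action on $Z$. The *conjugate* bimodule $\widetilde Z=\{\tilde z: z\in Z\}$ is the conjugate vector space with $b\cdot\tilde z\cdot a=(a^*\cdot z\cdot b^*)^{\sim}$ and $\langle\tilde z,\tilde\zeta\rangle_A={}_A\langle z,\zeta\rangle$; it is a right Hilbert $B$-$A$-bimodule, and $\widetilde\delta(g)\tilde z=(\delta(g)z)^{\sim}$ defines a $(\Theta,\Sigma)$-compatible action on it. $\mathcal A(\Sigma)$ denotes the collection of equivariant isomorphism classes $[X,v]$ of $(\Sigma,\Sigma)$-compatible actions $v$ on right Hilbert $A$-$A$-bimodules $X$, with the product $[X_1,v_1][X_2,v_2]=[X_1\otimes_AX_2,\,v_1\otimes_Av_2]$ and the element $1=[A,\alpha]$. An *equivariant representation* of $\Sigma$ on a right Hilbert $A$-module $X$ is a pair $(\rho,v)$ of a unital $*$-homomorphism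 $\rho:A\to\mathcal L_A(X)$ and a map $v:G\to\mathcal I(X)$ with $\rho(\alpha_g(a))=v(g)\rho(a)v(g)^{-1}$, $v(g)v(h)x=(\rho(\sigma(g,h))\,v(gh)x)\cdot\sigma(g,h)^*$, $\alpha_g(\langle x,x'\rangle)=\langle v(g)x,v(g)x'\rangle$ and $v(g)(x\cdot a)=(v(g)x)\cdot\alpha_g(a)$. Two of them, $(\rho,v)$ on $X$ and $(\rho',v')$ on $X'$, are *isomorphic* if there is an isomorphism $X\to X'$ of right Hilbert $A$-modules that intertwines $\rho$ with $\rho'$ and $v$ with $v'$. **Proposition.** Suppose $\Sigma\sim_{(Z,\delta)}\Theta$. For a $(\Sigma,\Sigma)$-compatible action $v$ on a right Hilbert $A$-$A$-bimodule $X$ put $$Y=(\widetilde Z\otimes_AX)\otimes_AZ,\qquad w=(\widetilde\delta\otimes_Av)\otimes_A\delta .$$ 1. $w$ is a $(\Theta,\Theta)$-compatible action on the right Hilbert $B$-$B$-bimodule $Y$, and $w(g)\big((\tilde z\otimes x)\otimes z'\big)=\big((\delta(g)z)^{\sim}\otimes v(g)x\big)\otimes\delta(g)z'$ for all $g\in G$,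 $z,z'\in Z$, $x\in X$. 2. The $(\Sigma,\Sigma)$-compatible action $\delta\otimes_B(w\otimes_B\widetilde\delta)$ on $Z\otimes_B(Y\otimes_B\widetilde Z)$ is equivariantly isomorphic to $v$. 3. The products of $\mathcal A(\Sigma)$ and $\mathcal A(\Theta)$ are associative, with units $[A,\alpha]$ and $[B,\beta]$, and $[X,v]\mapsto[Y,w]$ is a well defined bijection $\mathcal A(\Sigma)\to\mathcal A(\Theta)$ which preserves products and units. 4. If $(\rho,v)$ is an equivariant representation of $\Sigma$ on $X$, regard $X$ as a right Hilbert $A$-$A$-bimodule through $\rho$, form $(Y,w)$ as above, and let $\tau:B\to\mathcal L_B(Y)$ be the left action of $B$ on $Y$. Then $(\tau,w)$ is an equivariant representation of $\Theta$ on $Y$, and $(\rho,v)\mapsto(\tau,w)$ induces a bijection between the isomorphism classes of equivariant representations of $\Sigma$ and those of $\Theta$. -/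

import Mathlib

open scoped TensorProduct

set_option linter.unusedSectionVars false

namespace CStarMorita

open MulOpposite

/-- A semi-inner product `B`-module: a complex vector space `E` with a (unital, `ℂ`-compatible)
right action of `B` and a `B`-valued semi-inner product, conjugate linear in the first variable,
linear in the second one, and possibly degenerate. -/
structure PreHilbertModule (B E : Type*) [CStarAlgebra B] [PartialOrder B]
    [AddCommGroup E] [Module ℂ E] where
  /-- `rsmul (op b) x` is `x · b`. -/
  rsmul : Bᵐᵒᵖ →ₐ[ℂ] Module.End ℂ E
  inner : E →ₗ⋆[ℂ] E →ₗ[ℂ] B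
  inner_rsmul : ∀ x y b, inner x (rsmul (op b) y) = inner x y * b
  star_inner : ∀ x y, star (inner x y) = inner y x
  inner_self_nonneg : ∀ x, 0 ≤ inner x x

lemma exists_conj_eq_neg_pow {D : Type*} [CStarAlgebra D] [PartialOrder D] [StarOrderedRing D]
    {P : D} (hP : IsSelfAdjoint P) :
    ∃ N : D, 0 ≤ N ∧ star N * P * N = - N ^ 3 ∧ (N = 0 → 0 ≤ P) := by
  have hdiff := CFC.posPart_sub_negPart P hP
  have hN0 : 0 ≤ P⁻ := CFC.negPart_nonneg P
  refine ⟨P⁻, hN0, ?_, fun h => ?_⟩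
  · rw [(IsSelfAdjoint.of_nonneg hN0).star_eq]
    nth_rewrite 2 [← hdiff]
    rw [mul_sub, sub_mul, CFC.negPart_mul_posPart]
    noncomm_ring
  · rw [← hdiff, h, sub_zero]
    exact CFC.posPart_nonneg P

lemma exists_eq_star_mul_self {D : Type*} [CStarAlgebra D] [PartialOrder D] [StarOrderedRing D]
    {P : D} (hP : 0 ≤ P) : ∃ R, P = star R * R :=
  CStarAlgebra.nonneg_iff_eq_star_mul_self.1 hP

namespace PreHilbertModule

variable {B E : Type*} [CStarAlgebra B] [PartialOrder B] [AddCommGroup E] [Module ℂ E]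

/-- A representation of `A` by adjointable operators, `⟨a x, y⟩ = ⟨x, a⋆ y⟩`. -/
structure Rep (A : Type*) [CStarAlgebra A] (p : PreHilbertModule B E) where
  lsmul : A →ₐ[ℂ] Module.End ℂ E
  inner_lsmul : ∀ a x y, p.inner (lsmul a x) y = p.inner x (lsmul (star a) y)

variable (p : PreHilbertModule B E)

lemma inner_rsmul_left (x y : E) (b : B) :
    p.inner (p.rsmul (op b) x) y = star b * p.inner x y := by
  rw [← p.star_inner, p.inner_rsmul, star_mul, p.star_inner]

variable [StarOrderedRing B]

lemma star_inner_mul_inner_le (x y : E) {c : ℝ} (hc : ‖p.inner x x‖ < c) :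
    star (p.inner x y) * p.inner x y ≤ c • p.inner y y := by
  have hc0 : 0 < c := (norm_nonneg _).trans_lt hc
  set b := p.inner x y with hb
  have h1 := p.inner_self_nonneg (p.rsmul (op b) x - (c : ℂ) • y)
  have h2 : p.inner (p.rsmul (op b) x - (c : ℂ) • y) (p.rsmul (op b) x - (c : ℂ) • y)
      = star b * p.inner x x * b - (2 * c) • (star b * b) + c ^ 2 • p.inner y y := by
    have h3 : p.inner y x = star b := by rw [hb, p.star_inner]
    simp only [map_sub, LinearMap.sub_apply, map_smulₛₗ, LinearMap.smul_apply, p.inner_rsmul,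
      p.inner_rsmul_left, h3, ← hb, Complex.conj_ofReal, RingHom.id_apply, mul_assoc]
    simp only [Complex.coe_smul]
    module
  have h4 : star b * p.inner x x * b ≤ c • (star b * b) := by
    have := CStarAlgebra.star_left_conjugate_le_norm_smul (a := b) (b := p.inner x x)
      (p.star_inner x x)
    refine this.trans ?_
    exact smul_le_smul_of_nonneg_right hc.le (star_mul_self_nonneg b)
  have h5 : 0 ≤ c • (c • p.inner y y - star b * b) := by
    have : c • (c • p.inner y y - star b * b) =
        (star b * p.inner x x * b - (2 * c) • (star b * b) + c ^ 2 • p.inner y y) +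
        (c • (star b * b) - star b * p.inner x x * b) := by module
    rw [this]
    exact add_nonneg (h2 ▸ h1) (sub_nonneg.2 h4)
  have h6 := smul_nonneg (inv_nonneg.2 hc0.le) h5
  rw [smul_smul, inv_mul_cancel₀ hc0.ne', one_smul] at h6
  exact sub_nonneg.1 h6

lemma norm_inner_sq_le (x y : E) : ‖p.inner x y‖ ^ 2 ≤ ‖p.inner x x‖ * ‖p.inner y y‖ := by
  have key : ∀ c, ‖p.inner x x‖ < c → ‖p.inner x y‖ ^ 2 ≤ c * ‖p.inner y y‖ := by
    intro c hc
    have hc0 : 0 < c := (norm_nonneg _).trans_lt hc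
    have h := CStarAlgebra.norm_le_norm_of_nonneg_of_le (star_mul_self_nonneg _)
      (p.star_inner_mul_inner_le x y hc)
    rw [CStarRing.norm_star_mul_self, norm_smul, Real.norm_of_nonneg hc0.le, ← sq] at h
    exact h
  refine ge_of_tendsto (x := nhdsWithin ‖p.inner x x‖ (Set.Ioi ‖p.inner x x‖))
    (f := fun c => c * ‖p.inner y y‖) ?_ ?_
  · exact ((continuous_id.mul continuous_const).tendsto _).mono_left nhdsWithin_le_nhds
  · filter_upwards [self_mem_nhdsWithin] with c hc using key c hc

/-- The seminorm `‖x‖ = ‖⟨x, x⟩‖ ^ (1 / 2)`. -/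
noncomputable def nrm (x : E) : ℝ := √‖p.inner x x‖

lemma nrm_sq (x : E) : p.nrm x ^ 2 = ‖p.inner x x‖ := Real.sq_sqrt (norm_nonneg _)

lemma nrm_nonneg (x : E) : 0 ≤ p.nrm x := Real.sqrt_nonneg _

lemma norm_inner_le (x y : E) : ‖p.inner x y‖ ≤ p.nrm x * p.nrm y := by
  refine le_of_sq_le_sq ?_ (mul_nonneg (p.nrm_nonneg x) (p.nrm_nonneg y))
  rw [mul_pow, nrm_sq, nrm_sq]
  exact p.norm_inner_sq_le x y

lemma nrm_smul (c : ℂ) (x : E) : p.nrm (c • x) = ‖c‖ * p.nrm x := by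
  simp [nrm, norm_smul, ← mul_assoc]

lemma nrm_add_le (x y : E) : p.nrm (x + y) ≤ p.nrm x + p.nrm y := by
  refine le_of_sq_le_sq ?_ (add_nonneg (p.nrm_nonneg x) (p.nrm_nonneg y))
  rw [nrm_sq]
  have : p.inner (x + y) (x + y) = p.inner x x + p.inner x y + p.inner y x + p.inner y y := by
    simp; abel
  rw [this]
  have h1 := p.norm_inner_le x y
  have h2 := p.norm_inner_le y x
  have h3 := p.nrm_sq x
  have h4 := p.nrm_sq y
  have h5 := norm_add_le (p.inner x x + p.inner x y + p.inner y x) (p.inner y y)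
  have h6 := norm_add₃_le (a := p.inner x x) (b := p.inner x y) (c := p.inner y x)
  nlinarith

lemma nrm_rsmul_le (b : B) (x : E) : p.nrm (p.rsmul (op b) x) ≤ ‖b‖ * p.nrm x := by
  refine le_of_sq_le_sq ?_ (mul_nonneg (norm_nonneg _) (p.nrm_nonneg x))
  rw [nrm_sq, p.inner_rsmul, p.inner_rsmul_left, mul_pow, nrm_sq]
  calc _ ≤ ‖star b‖ * ‖p.inner x x‖ * ‖b‖ :=
        (norm_mul_le _ _).trans (mul_le_mul_of_nonneg_right (norm_mul_le _ _) (norm_nonneg _))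
    _ = _ := by rw [norm_star]; ring

lemma inner_lsmul_le {A : Type*} [CStarAlgebra A] (r : p.Rep A) (a : A) (x : E) :
    p.inner (r.lsmul a x) (r.lsmul a x) ≤ (‖a‖ ^ 2) • p.inner x x := by
  let _ := CStarAlgebra.spectralOrder A
  have _ := CStarAlgebra.spectralOrderedRing A
  have h := sub_nonneg.2 (CStarAlgebra.star_mul_le_algebraMap_norm_sq (a := a))
  obtain ⟨d, hd⟩ := CStarAlgebra.nonneg_iff_eq_star_mul_self.1 h
  have h1 := p.inner_self_nonneg (r.lsmul d x)
  have h2 : ∀ c : A, p.inner (r.lsmul c x) (r.lsmul c x) = p.inner x (r.lsmul (star c * c) x) := by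
    intro c; rw [r.inner_lsmul, map_mul]; rfl
  rw [h2, ← hd] at h1
  rw [h2]
  have h3 : algebraMap ℝ A (‖a‖ ^ 2) = algebraMap ℂ A ((‖a‖ ^ 2 : ℝ) : ℂ) := by
    rw [Algebra.algebraMap_eq_smul_one, Algebra.algebraMap_eq_smul_one, Complex.coe_smul]
  rw [h3, map_sub, AlgHom.commutes, LinearMap.sub_apply, map_sub,
    Module.algebraMap_end_apply, map_smul, Complex.coe_smul] at h1
  exact sub_nonneg.1 h1

lemma nrm_lsmul_le {A : Type*} [CStarAlgebra A] (r : p.Rep A) (a : A) (x : E) :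
    p.nrm (r.lsmul a x) ≤ ‖a‖ * p.nrm x := by
  refine le_of_sq_le_sq ?_ (mul_nonneg (norm_nonneg _) (p.nrm_nonneg x))
  rw [nrm_sq, mul_pow, nrm_sq]
  have h := CStarAlgebra.norm_le_norm_of_nonneg_of_le (p.inner_self_nonneg _)
    (p.inner_lsmul_le r a x)
  rwa [norm_smul, Real.norm_of_nonneg (by positivity)] at h


lemma exists_gram_factor {n : ℕ} (x : Fin n → E) :
    ∃ R : Fin n → Fin n → B, ∀ i j, p.inner (x i) (x j) = ∑ k, star (R k i) * R k j := by
  let _ : PartialOrder (CStarMatrix (Fin n) (Fin n) B) := CStarAlgebra.spectralOrder _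
  have _ : StarOrderedRing (CStarMatrix (Fin n) (Fin n) B) := CStarAlgebra.spectralOrderedRing _
  set P : CStarMatrix (Fin n) (Fin n) B :=
    CStarMatrix.ofMatrix (fun i j => p.inner (x i) (x j)) with hP
  have hPij : ∀ i j, P i j = p.inner (x i) (x j) := fun _ _ => rfl
  have hsa : IsSelfAdjoint P := by
    ext i j
    rw [CStarMatrix.star_apply, hPij, hPij, p.star_inner]
  obtain ⟨N, hN0, hM, hNP⟩ := exists_conj_eq_neg_pow hsa
  have hNsa : star N = N := IsSelfAdjoint.of_nonneg hN0
  have hN3 : 0 ≤ N ^ 3 := CStarAlgebra.pow_nonneg hN0 3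
  obtain ⟨Q, hQ⟩ := exists_eq_star_mul_self hN3
  have hdiag : ∀ i, 0 ≤ (star N * P * N) i i := by
    intro i
    have : (star N * P * N) i i =
        p.inner (∑ k, p.rsmul (op (N k i)) (x k)) (∑ k, p.rsmul (op (N k i)) (x k)) := by
      simp only [map_sum, LinearMap.sum_apply, p.inner_rsmul, p.inner_rsmul_left,
        CStarMatrix.mul_apply, CStarMatrix.star_apply, hPij]
      simp only [Finset.sum_mul]
    rw [this]
    exact p.inner_self_nonneg _
  have hQ0 : Q = 0 := by
    ext k i
    have h1 : (N ^ 3) i i = ∑ k, star (Q k i) * Q k i := by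
      rw [hQ]; simp only [CStarMatrix.mul_apply, CStarMatrix.star_apply]
    have h2 := hdiag i
    rw [hM, CStarMatrix.neg_apply, h1, neg_nonneg] at h2
    have h3 : star (Q k i) * Q k i ≤ 0 :=
      (Finset.single_le_sum (f := fun k => star (Q k i) * Q k i)
        (fun _ _ => star_mul_self_nonneg _) (Finset.mem_univ k)).trans h2
    exact CStarRing.star_mul_self_eq_zero_iff _ |>.1 (le_antisymm h3 (star_mul_self_nonneg _))
  have hN3' : N ^ 3 = 0 := by rw [hQ, hQ0, mul_zero]
  have hNz : N = 0 := by
    have h4 : star (N ^ 2) * N ^ 2 = 0 := by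
      rw [star_pow, hNsa, ← pow_add, show 2 + 2 = 3 + 1 from rfl, pow_succ, hN3', zero_mul]
    have h5 : N ^ 2 = 0 := (CStarRing.star_mul_self_eq_zero_iff _).1 h4
    refine (CStarRing.star_mul_self_eq_zero_iff _).1 ?_
    rw [hNsa, ← sq, h5]
  have hP0 : 0 ≤ P := hNP hNz
  obtain ⟨R, hR⟩ := exists_eq_star_mul_self hP0
  refine ⟨fun k i => R k i, fun i j => ?_⟩
  rw [← hPij, hR]
  simp only [CStarMatrix.mul_apply, CStarMatrix.star_apply]

section Tensor

variable {C F : Type*} [CStarAlgebra C] [PartialOrder C] [AddCommGroup F] [Module ℂ F]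
  {q : PreHilbertModule C F} (r : q.Rep B)

lemma inner_lsmul_rsmul (b : B) (c : C) (y y' : F) :
    q.inner y (r.lsmul b (q.rsmul (op c) y')) = q.inner y (r.lsmul b y') * c := by
  have h := r.inner_lsmul (star b) y
  simp only [star_star] at h
  rw [← h, ← h, q.inner_rsmul]

/-- The sesquilinear map determined by `⟨x ⊗ y, x' ⊗ y'⟩ = ⟨y, ⟨x, x'⟩ · y'⟩`. -/
noncomputable def tensorInner : E ⊗[ℂ] F →ₗ⋆[ℂ] E ⊗[ℂ] F →ₗ[ℂ] C :=
  TensorProduct.lift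
    (LinearMap.mk₂'ₛₗ (starRingEnd ℂ) (starRingEnd ℂ)
      (fun x y => TensorProduct.lift
        (LinearMap.mk₂ ℂ (fun x' y' => q.inner y (r.lsmul (p.inner x x') y'))
          (by intros; simp) (by intros; simp) (by intros; simp) (by intros; simp)))
      (by intros; ext; simp) (by intros; ext; simp) (by intros; ext; simp) (by intros; ext; simp))

@[simp]
lemma tensorInner_tmul (x x' : E) (y y' : F) :
    p.tensorInner r (x ⊗ₜ y) (x' ⊗ₜ y') = q.inner y (r.lsmul (p.inner x x') y') := by
  simp [tensorInner]

lemma tensorInner_self_nonneg [StarOrderedRing C] (t : E ⊗[ℂ] F) : 0 ≤ p.tensorInner r t t := by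
  obtain ⟨n, x, y, rfl⟩ : ∃ (n : ℕ) (x : Fin n → E) (y : Fin n → F), t = ∑ i, x i ⊗ₜ[ℂ] y i := by
    obtain ⟨S, hS⟩ := TensorProduct.exists_finset t
    refine ⟨S.card, fun i => (S.equivFin.symm i).1.1, fun i => (S.equivFin.symm i).1.2, ?_⟩
    rw [hS, ← Finset.sum_coe_sort]
    exact (Equiv.sum_comp S.equivFin.symm (fun s : S => s.1.1 ⊗ₜ[ℂ] s.1.2)).symm
  obtain ⟨R, hR⟩ := p.exists_gram_factor x
  have : p.tensorInner r (∑ i, x i ⊗ₜ[ℂ] y i) (∑ i, x i ⊗ₜ[ℂ] y i) =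
      ∑ k, q.inner (∑ i, r.lsmul (R k i) (y i)) (∑ i, r.lsmul (R k i) (y i)) := by
    simp only [map_sum, LinearMap.sum_apply, tensorInner_tmul, hR, r.inner_lsmul, map_mul,
      Module.End.mul_apply]
    rw [Finset.sum_congr rfl (fun _ _ => Finset.sum_comm), Finset.sum_comm]
  rw [this]
  exact Finset.sum_nonneg fun k _ => q.inner_self_nonneg _

/-- The algebraic tensor product with its semi-inner product. -/
noncomputable def tensor [StarOrderedRing C] : PreHilbertModule C (E ⊗[ℂ] F) where
  rsmul := (Module.End.lTensorAlgHom ℂ F E).comp q.rsmul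
  inner := p.tensorInner r
  inner_rsmul s t c := by
    induction s with
    | zero => simp
    | add s s' h h' => simp only [map_add, LinearMap.add_apply, h, h', add_mul]
    | tmul x y =>
      induction t with
      | zero => simp
      | add s s' h h' => simp only [map_add, h, h', add_mul]
      | tmul x' y' =>
        exact (p.tensorInner_tmul r _ _ _ _).trans ((q.inner_lsmul_rsmul r _ _ _ _).trans
          (congrArg (· * c) (p.tensorInner_tmul r _ _ _ _).symm))
  star_inner s t := by
    induction s with
    | zero => simp
    | add s s' h h' => simp only [map_add, LinearMap.add_apply, h, h', star_add]
    | tmul x y =>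
      induction t with
      | zero => simp
      | add s s' h h' => simp only [map_add, LinearMap.add_apply, h, h', star_add]
      | tmul x' y' => simp [q.star_inner, r.inner_lsmul, p.star_inner]
  inner_self_nonneg := p.tensorInner_self_nonneg r

/-- `A` acts on the algebraic tensor product through the first factor. -/
noncomputable def Rep.tensor {A : Type*} [CStarAlgebra A] [StarOrderedRing C]
    {p : PreHilbertModule B E} (l : p.Rep A)
    (r : q.Rep B) : (p.tensor r).Rep A where
  lsmul := (Module.End.rTensorAlgHom ℂ E F).comp l.lsmul
  inner_lsmul a s t := by
    induction s with
    | zero => simp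
    | add s s' h h' => simp only [map_add, LinearMap.add_apply, h, h']
    | tmul x y =>
      induction t with
      | zero => simp
      | add s s' h h' => simp only [map_add, h, h']
      | tmul x' y' =>
        refine (p.tensorInner_tmul r _ _ _ _).trans (Eq.trans ?_
          (p.tensorInner_tmul r _ _ _ _).symm)
        exact congrArg (fun b => q.inner y (r.lsmul b y')) (l.inner_lsmul a x x')

end Tensor

section Completion

open UniformSpace

variable {V : Type*} [SeminormedAddCommGroup V] [NormedSpace ℂ V] (p : PreHilbertModule B V)

/-- The seminorm of the space is the one of the semi-inner product. -/
def IsNorm : Prop := ∀ x, ‖x‖ = √‖p.inner x x‖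

variable {p}

/-- The semi-inner product as a bounded sesquilinear map. -/
noncomputable def innerCLM (hp : p.IsNorm) : V →L⋆[ℂ] V →L[ℂ] B :=
  LinearMap.mkContinuous₂ p.inner 1 (fun x y => by
    rw [one_mul, hp x, hp y]; exact p.norm_inner_le _ _)

/-- The extension of the semi-inner product to the completion. -/
noncomputable def complInnerFun (p : PreHilbertModule B V) (x y : Completion V) : B :=
  (Completion.isDenseInducing_coe.prodMap Completion.isDenseInducing_coe).extend
    (fun z : V × V => p.inner z.1 z.2) (x, y)

lemma continuous_inner (hp : p.IsNorm) : Continuous (fun z : V × V => p.inner z.1 z.2) := by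
  exact ((innerCLM hp).continuous.comp continuous_fst).clm_apply continuous_snd

lemma complInnerFun_coe (hp : p.IsNorm) (x y : V) : p.complInnerFun (x : Completion V) y = p.inner x y :=
  (Completion.isDenseInducing_coe.prodMap Completion.isDenseInducing_coe).extend_eq
    (continuous_inner hp) (x, y)

lemma continuous_complInnerFun' (hp : p.IsNorm) :
    Continuous (fun z : Completion V × Completion V => p.complInnerFun z.1 z.2) := by
  let φ : V →+ V →+ B :=
    { toFun := fun x => (p.inner x).toAddMonoidHom
      map_zero' := by ext x; simp
      map_add' := fun x y => by ext z; simp }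
  have : Continuous fun z : V × V => φ z.1 z.2 := continuous_inner hp
  have h := (Completion.isDenseInducing_toCompl V).extend_Z_bilin
    (Completion.isDenseInducing_toCompl V) this
  exact h

lemma continuous_complInnerFun (hp : p.IsNorm) {T : Type*} [TopologicalSpace T] {f g : T → Completion V}
    (hf : Continuous f) (hg : Continuous g) : Continuous fun t => p.complInnerFun (f t) (g t) :=
  (continuous_complInnerFun' hp).comp (hf.prodMk hg)

lemma complInnerFun_add_left (hp : p.IsNorm) (x y z : Completion V) :
    p.complInnerFun (x + y) z = p.complInnerFun x z + p.complInnerFun y z := by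
  have h := continuous_complInnerFun' hp
  induction x, y, z using Completion.induction_on₃ with
  | hp =>
    have h1 : Continuous fun t : Completion V × Completion V × Completion V =>
        p.complInnerFun (t.1 + t.2.1) t.2.2 := h.comp₂ (by fun_prop) (by fun_prop)
    have h2 : Continuous fun t : Completion V × Completion V × Completion V =>
        p.complInnerFun t.1 t.2.2 + p.complInnerFun t.2.1 t.2.2 :=
      (h.comp₂ (by fun_prop) (by fun_prop)).add (h.comp₂ (by fun_prop) (by fun_prop))
    exact isClosed_eq h1 h2
  | ih x y z =>
    simp only [← Completion.coe_add, complInnerFun_coe hp, map_add, LinearMap.add_apply]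

lemma complInnerFun_add_right (hp : p.IsNorm) (x y z : Completion V) :
    p.complInnerFun x (y + z) = p.complInnerFun x y + p.complInnerFun x z := by
  have h := continuous_complInnerFun' hp
  induction x, y, z using Completion.induction_on₃ with
  | hp =>
    have h1 : Continuous fun t : Completion V × Completion V × Completion V =>
        p.complInnerFun t.1 (t.2.1 + t.2.2) := h.comp₂ (by fun_prop) (by fun_prop)
    have h2 : Continuous fun t : Completion V × Completion V × Completion V =>
        p.complInnerFun t.1 t.2.1 + p.complInnerFun t.1 t.2.2 :=
      (h.comp₂ (by fun_prop) (by fun_prop)).add (h.comp₂ (by fun_prop) (by fun_prop))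
    exact isClosed_eq h1 h2
  | ih x y z => simp only [← Completion.coe_add, complInnerFun_coe hp, map_add]

lemma complInnerFun_smul_left (hp : p.IsNorm) (c : ℂ) (x y : Completion V) :
    p.complInnerFun (c • x) y = starRingEnd ℂ c • p.complInnerFun x y := by
  have h := continuous_complInnerFun' hp
  induction x, y using Completion.induction_on₂ with
  | hp =>
    have h1 : Continuous fun t : Completion V × Completion V =>
        p.complInnerFun (c • t.1) t.2 := h.comp₂ (continuous_fst.const_smul c) continuous_snd
    exact isClosed_eq h1 ((continuous_const_smul _).comp h)
  | ih x y =>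
    simp only [← Completion.coe_smul, complInnerFun_coe hp, map_smulₛₗ, LinearMap.smul_apply]

lemma complInnerFun_smul_right (hp : p.IsNorm) (c : ℂ) (x y : Completion V) :
    p.complInnerFun x (c • y) = c • p.complInnerFun x y := by
  have h := continuous_complInnerFun' hp
  induction x, y using Completion.induction_on₂ with
  | hp =>
    have h1 : Continuous fun t : Completion V × Completion V =>
        p.complInnerFun t.1 (c • t.2) := h.comp₂ continuous_fst (continuous_snd.const_smul c)
    exact isClosed_eq h1 ((continuous_const_smul _).comp h)
  | ih x y => simp only [← Completion.coe_smul, complInnerFun_coe hp, map_smul]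

/-- The extension of the semi-inner product to the completion, as a sesquilinear map. -/
noncomputable def complInner (hp : p.IsNorm) : Completion V →ₗ⋆[ℂ] Completion V →ₗ[ℂ] B :=
  LinearMap.mk₂'ₛₗ (starRingEnd ℂ) (RingHom.id ℂ) p.complInnerFun
    (complInnerFun_add_left hp) (complInnerFun_smul_left hp)
    (complInnerFun_add_right hp) (complInnerFun_smul_right hp)

lemma continuous_complInner (hp : p.IsNorm) {T : Type*} [TopologicalSpace T] {f g : T → Completion V}
    (hf : Continuous f) (hg : Continuous g) : Continuous fun t => complInner hp (f t) (g t) :=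
  continuous_complInnerFun hp hf hg

@[simp]
lemma complInner_coe (hp : p.IsNorm) (x y : V) : complInner hp (x : Completion V) y = p.inner x y :=
  complInnerFun_coe hp x y

/-- The extension to the completions of a bounded linear map. -/
noncomputable def complMap {W : Type*} [SeminormedAddCommGroup W] [NormedSpace ℂ W]
    (f : V →ₗ[ℂ] W) (h : ∃ c : ℝ, ∀ x, ‖f x‖ ≤ c * ‖x‖) : Completion V →L[ℂ] Completion W :=
  (LinearMap.mkContinuousOfExistsBound f h).completion

@[simp]
lemma complMap_coe {W : Type*} [SeminormedAddCommGroup W] [NormedSpace ℂ W]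
    (f : V →ₗ[ℂ] W) (h : ∃ c : ℝ, ∀ x, ‖f x‖ ≤ c * ‖x‖) (x : V) :
    complMap f h (x : Completion V) = f x :=
  ContinuousLinearMap.completion_apply_coe _ _

/-- An algebra acting by bounded operators acts on the completion. -/
noncomputable def complAlgHom {R : Type*} [Ring R] [Algebra ℂ R] (φ : R →ₐ[ℂ] Module.End ℂ V)
    (h : ∀ a, ∃ c : ℝ, ∀ x, ‖φ a x‖ ≤ c * ‖x‖) :
    R →ₐ[ℂ] Module.End ℂ (Completion V) :=
  AlgHom.ofLinearMap
    { toFun := fun a => (complMap (φ a) (h a)).toLinearMap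
      map_add' := fun a b => by
        ext x
        change complMap (φ (a + b)) (h _) x = complMap (φ a) (h a) x + complMap (φ b) (h b) x
        induction x using Completion.induction_on with
        | hp =>
          exact isClosed_eq (complMap _ _).continuous
            ((complMap _ _).continuous.fun_add (complMap _ _).continuous)
        | ih x => simp [Completion.coe_add]
      map_smul' := fun c a => by
        ext x
        change complMap (φ (c • a)) (h _) x = c • complMap (φ a) (h a) x
        induction x using Completion.induction_on with
        | hp =>
          exact isClosed_eq (complMap _ _).continuous ((complMap _ _).continuous.fun_const_smul c)
        | ih x => simp [Completion.coe_smul] }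
    (by
      ext x
      change complMap (φ 1) (h 1) x = x
      induction x using Completion.induction_on with
      | hp =>
        exact isClosed_eq (complMap _ _).continuous continuous_id
      | ih x => simp)
    (fun a b => by
      ext x
      change complMap (φ (a * b)) (h _) x = complMap (φ a) (h a) (complMap (φ b) (h b) x)
      induction x using Completion.induction_on with
      | hp =>
        exact isClosed_eq (complMap _ _).continuous
          ((complMap _ _).continuous.comp (complMap _ _).continuous)
      | ih x => simp)

@[simp]
lemma complAlgHom_coe {R : Type*} [Ring R] [Algebra ℂ R] (φ : R →ₐ[ℂ] Module.End ℂ V)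
    (h : ∀ a, ∃ c : ℝ, ∀ x, ‖φ a x‖ ≤ c * ‖x‖) (a : R) (x : V) :
    complAlgHom φ h a (x : Completion V) =
      (φ a x : V) :=
  complMap_coe (φ a) (h a) x

lemma continuous_complAlgHom {R : Type*} [Ring R] [Algebra ℂ R] (φ : R →ₐ[ℂ] Module.End ℂ V)
    (h : ∀ a, ∃ c : ℝ, ∀ x, ‖φ a x‖ ≤ c * ‖x‖) (a : R) :
    Continuous (complAlgHom φ h a) := (complMap (φ a) (h a)).continuous

lemma bound_rsmul (hp : p.IsNorm) (b : Bᵐᵒᵖ) : ∃ c : ℝ, ∀ x, ‖p.rsmul b x‖ ≤ c * ‖x‖ :=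
  ⟨_, fun x => by rw [hp, hp]; exact p.nrm_rsmul_le (unop b) x⟩

lemma bound_lsmul (hp : p.IsNorm) {A : Type*} [CStarAlgebra A] (l : p.Rep A) (a : A) :
    ∃ c : ℝ, ∀ x, ‖l.lsmul a x‖ ≤ c * ‖x‖ :=
  ⟨_, fun x => by rw [hp, hp]; exact p.nrm_lsmul_le l a x⟩

/-- The completion of a semi-inner product module. -/
noncomputable def compl (hp : p.IsNorm) : PreHilbertModule B (Completion V) where
  rsmul := complAlgHom p.rsmul (bound_rsmul hp)
  inner := complInner hp
  inner_rsmul x y b := by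
    have h := continuous_complAlgHom p.rsmul (bound_rsmul hp) (op b)
    induction x, y using Completion.induction_on₂ with
    | hp =>
      exact isClosed_eq (continuous_complInner hp continuous_fst (h.comp continuous_snd))
        ((continuous_complInner hp continuous_fst continuous_snd).mul continuous_const)
    | ih x y => simp [p.inner_rsmul]
  star_inner x y := by
    induction x, y using Completion.induction_on₂ with
    | hp =>
      exact isClosed_eq (continuous_complInner hp continuous_fst continuous_snd).star
        (continuous_complInner hp continuous_snd continuous_fst)
    | ih x y => simp [p.star_inner]
  inner_self_nonneg x := by
    induction x using Completion.induction_on with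
    | hp =>
      exact isClosed_le continuous_const (continuous_complInner hp continuous_id continuous_id)
    | ih x => simpa using p.inner_self_nonneg _

lemma norm_compl (hp : p.IsNorm) (x : Completion V) : ‖x‖ = √‖(compl hp).inner x x‖ := by
  change ‖x‖ = √‖complInner hp x x‖
  induction x using Completion.induction_on with
  | hp =>
    exact isClosed_eq continuous_norm
      (continuous_complInner hp continuous_id continuous_id).norm.sqrt
  | ih x => simp [hp x]

/-- The extension of a representation to the completion. -/
noncomputable def Rep.compl (hp : p.IsNorm) {A : Type*} [CStarAlgebra A] (l : p.Rep A) :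
    (compl hp).Rep A where
  lsmul := complAlgHom l.lsmul (bound_lsmul hp l)
  inner_lsmul a x y := by
    have h := continuous_complAlgHom l.lsmul (bound_lsmul hp l)
    change complInner hp _ _ = complInner hp _ _
    induction x, y using Completion.induction_on₂ with
    | hp =>
      exact isClosed_eq
        (continuous_complInner hp ((h a).comp continuous_fst) continuous_snd)
        (continuous_complInner hp continuous_fst ((h (star a)).comp continuous_snd))
    | ih x y => simp [l.inner_lsmul]

end Completion

section Space

/-- The space `E` with the seminorm of the semi-inner product `p`. -/
def Space (_p : PreHilbertModule B E) : Type _ := E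

instance : AddCommGroup p.Space := inferInstanceAs (AddCommGroup E)
instance : Module ℂ p.Space := inferInstanceAs (Module ℂ E)
noncomputable instance : Norm p.Space := ⟨fun x => p.nrm x⟩

noncomputable instance : SeminormedAddCommGroup p.Space :=
  SeminormedAddCommGroup.ofCore (𝕜 := ℂ)
    { norm_nonneg := p.nrm_nonneg
      norm_smul := p.nrm_smul
      norm_triangle := p.nrm_add_le }

noncomputable instance : NormedSpace ℂ p.Space where
  norm_smul_le c x := (p.nrm_smul c x).le

/-- The identity map from `E` to `E` with the seminorm of `p`. -/
def toSpace : E ≃ₗ[ℂ] p.Space := LinearEquiv.refl ℂ E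

/-- The semi-inner product `p` on the seminormed space that it defines. -/
noncomputable def onSpace : PreHilbertModule B p.Space := { p with }

lemma isNorm_onSpace : p.onSpace.IsNorm := fun _ => rfl

end Space

end PreHilbertModule


universe u v w

/-- A right Hilbert `B`-module: complete for the norm `‖x‖ = ‖⟨x, x⟩‖ ^ (1 / 2)`. The inner product
is definite because this is a norm. -/
structure HilbertModule (B : Type u) [CStarAlgebra B] [PartialOrder B] [StarOrderedRing B] where
  carrier : Type w
  [normedAddCommGroup : NormedAddCommGroup carrier]
  [normedSpace : NormedSpace ℂ carrier]
  [completeSpace : CompleteSpace carrier]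
  pre : PreHilbertModule B carrier
  isNorm : pre.IsNorm

attribute [instance] HilbertModule.normedAddCommGroup HilbertModule.normedSpace
  HilbertModule.completeSpace

namespace HilbertModule

variable {B : Type u} [CStarAlgebra B] [PartialOrder B] [StarOrderedRing B]

instance : CoeSort (HilbertModule.{u, w} B) (Type w) := ⟨carrier⟩

variable (X : HilbertModule.{u, w} B)

/-- The inner product `⟨x, y⟩`. -/
noncomputable abbrev inner (x y : X) : B := X.pre.inner x y

/-- The right action `x · b`. -/
noncomputable abbrev rsmul (x : X) (b : B) : X := X.pre.rsmul (op b) x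

lemma norm_sq (x : X) : ‖x‖ ^ 2 = ‖X.inner x x‖ := by
  rw [X.isNorm x, Real.sq_sqrt (norm_nonneg _)]

lemma eq_zero_of_inner_self {x : X} (h : X.inner x x = 0) : x = 0 := by
  have := X.norm_sq x
  rw [h, norm_zero] at this
  exact norm_eq_zero.1 (pow_eq_zero_iff two_ne_zero |>.1 this)

lemma ext_inner {x y : X} (h : ∀ z, X.inner z x = X.inner z y) : x = y := by
  refine sub_eq_zero.1 (X.eq_zero_of_inner_self ?_)
  change X.pre.inner (x - y) (x - y) = 0
  rw [map_sub (X.pre.inner (x - y)), sub_eq_zero]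
  exact h _

end HilbertModule

/-- A right Hilbert `A`-`B`-bimodule: a right Hilbert `B`-module with a representation of `A` by
adjointable operators. -/
structure HilbertBimodule (A B : Type u) [CStarAlgebra A] [CStarAlgebra B] [PartialOrder B]
    [StarOrderedRing B] extends HilbertModule.{u, w} B where
  rep : pre.Rep A

namespace HilbertBimodule

variable {A B C : Type u} [CStarAlgebra A]
  [CStarAlgebra B] [PartialOrder B] [StarOrderedRing B]
  [CStarAlgebra C] [PartialOrder C] [StarOrderedRing C]

instance : CoeSort (HilbertBimodule.{u, w} A B) (Type w) := ⟨fun X => X.carrier⟩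

/-- The left action `a · x`. -/
noncomputable abbrev lsmul (X : HilbertBimodule.{u, w} A B) (a : A) (x : X) : X := X.rep.lsmul a x

lemma lsmul_rsmul (X : HilbertBimodule.{u, w} A B) (a : A) (x : X) (b : B) :
    X.lsmul a (X.rsmul x b) = X.rsmul (X.lsmul a x) b := by
  refine X.ext_inner fun z => ?_
  have h := X.rep.inner_lsmul (star a) z
  simp only [star_star] at h
  change X.pre.inner _ (X.rep.lsmul a _) = X.pre.inner _ (X.pre.rsmul _ _)
  rw [← h, X.pre.inner_rsmul, X.pre.inner_rsmul, h]

/-- An isomorphism of right Hilbert `A`-`B`-bimodules. -/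
structure Iso (X Y : HilbertBimodule.{u, w} A B) extends X ≃ₗ[ℂ] Y where
  map_lsmul : ∀ a x, toFun (X.lsmul a x) = Y.lsmul a (toFun x)
  map_rsmul : ∀ x b, toFun (X.rsmul x b) = Y.rsmul (toFun x) b
  inner_map : ∀ x y, Y.inner (toFun x) (toFun y) = X.inner x y

section Tensor

open UniformSpace PreHilbertModule

variable (X X' : HilbertBimodule.{u, w} A B) (Y Y' : HilbertBimodule.{u, w} B C)

/-- The algebraic tensor product, with the semi-inner product
`⟨x ⊗ y, x' ⊗ y'⟩ = ⟨y, ⟨x, x'⟩ · y'⟩`. -/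
noncomputable abbrev preTensor : PreHilbertModule C (X ⊗[ℂ] Y) := X.pre.tensor Y.rep

/-- The internal tensor product `X ⊗_B Y`: the (separated) completion of the algebraic tensor
product for the semi-inner product `⟨x ⊗ y, x' ⊗ y'⟩ = ⟨y, ⟨x, x'⟩ · y'⟩`. -/
noncomputable def tensor : HilbertBimodule.{u, w} A C where
  carrier := Completion (X.preTensor Y).Space
  pre := compl (X.preTensor Y).isNorm_onSpace
  isNorm := norm_compl (X.preTensor Y).isNorm_onSpace
  rep := Rep.compl (X.preTensor Y).isNorm_onSpace
    { lsmul := (X.rep.tensor Y.rep).lsmul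
      inner_lsmul := (X.rep.tensor Y.rep).inner_lsmul }

/-- The canonical map from the algebraic tensor product to the internal one. -/
noncomputable def ofTensor : X ⊗[ℂ] Y →ₗ[ℂ] X.tensor Y :=
  (Completion.toComplL (𝕜 := ℂ) (E := (X.preTensor Y).Space)).toLinearMap ∘ₗ
    (X.preTensor Y).toSpace.toLinearMap

/-- The simple tensor `x ⊗ y`. -/
noncomputable def tmul (x : X) (y : Y) : X.tensor Y := X.ofTensor Y (x ⊗ₜ y)

variable {X Y}

lemma denseRange_ofTensor : DenseRange (X.ofTensor Y) :=
  Completion.denseRange_coe (α := (X.preTensor Y).Space)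

lemma inner_ofTensor (s t : X ⊗[ℂ] Y) :
    (X.tensor Y).inner (X.ofTensor Y s) (X.ofTensor Y t) = X.pre.tensorInner Y.rep s t :=
  complInner_coe (X.preTensor Y).isNorm_onSpace _ _

lemma lsmul_ofTensor (a : A) (t : X ⊗[ℂ] Y) :
    (X.tensor Y).lsmul a (X.ofTensor Y t) = X.ofTensor Y ((X.rep.lsmul a).rTensor Y t) :=
  complAlgHom_coe _ _ _ _

lemma rsmul_ofTensor (t : X ⊗[ℂ] Y) (c : C) :
    (X.tensor Y).rsmul (X.ofTensor Y t) c = X.ofTensor Y ((Y.pre.rsmul (op c)).lTensor X t) :=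
  complAlgHom_coe _ _ _ _

lemma inner_tmul (x x' : X) (y y' : Y) :
    (X.tensor Y).inner (X.tmul Y x y) (X.tmul Y x' y') = Y.inner y (Y.lsmul (X.inner x x') y') :=
  (inner_ofTensor _ _).trans (X.pre.tensorInner_tmul Y.rep _ _ _ _)

lemma lsmul_tmul (a : A) (x : X) (y : Y) :
    (X.tensor Y).lsmul a (X.tmul Y x y) = X.tmul Y (X.lsmul a x) y :=
  lsmul_ofTensor _ _

lemma rsmul_tmul (x : X) (y : Y) (c : C) :
    (X.tensor Y).rsmul (X.tmul Y x y) c = X.tmul Y x (Y.rsmul y c) :=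
  rsmul_ofTensor _ _

variable {X' Y'}

/-- Two linear maps on the two factors which transform the semi-inner products by an automorphism
`γ`. -/
def TensorCompat (γ : C ≃⋆ₐ[ℂ] C) (f : X →ₗ[ℂ] X') (k : Y →ₗ[ℂ] Y') : Prop :=
  ∀ x x' y y', Y'.inner (k y) (Y'.lsmul (X'.inner (f x) (f x')) (k y')) =
    γ (Y.inner y (Y.lsmul (X.inner x x') y'))

variable {γ : C ≃⋆ₐ[ℂ] C} {f : X →ₗ[ℂ] X'} {k : Y →ₗ[ℂ] Y'}

lemma TensorCompat.inner_map (h : TensorCompat γ f k) (s t : X ⊗[ℂ] Y) :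
    (X'.preTensor Y').inner (TensorProduct.map f k s) (TensorProduct.map f k t) =
      γ ((X.preTensor Y).inner s t) := by
  induction s with
  | zero => simp
  | add s s' h h' => simp only [map_add, LinearMap.add_apply, h, h']
  | tmul x y =>
    induction t with
    | zero => simp
    | add s s' h h' => simp only [map_add, h, h']
    | tmul x' y' =>
      exact (X'.pre.tensorInner_tmul Y'.rep _ _ _ _).trans ((h x x' y y').trans
        (congrArg γ (X.pre.tensorInner_tmul Y.rep _ _ _ _).symm))

lemma TensorCompat.nrm_map (h : TensorCompat γ f k) (t : X ⊗[ℂ] Y) :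
    (X'.preTensor Y').nrm (TensorProduct.map f k t) = (X.preTensor Y).nrm t := by
  rw [nrm, nrm, h.inner_map, StarAlgEquiv.norm_map]

/-- The map `x ⊗ y ↦ f x ⊗ k y` of the internal tensor products. -/
noncomputable def tensorMap (h : TensorCompat γ f k) : X.tensor Y →L[ℂ] X'.tensor Y' :=
  complMap (V := (X.preTensor Y).Space) (W := (X'.preTensor Y').Space)
    ((X'.preTensor Y').toSpace.toLinearMap ∘ₗ TensorProduct.map f k ∘ₗ
      (X.preTensor Y).toSpace.symm.toLinearMap)
    ⟨1, fun t => by rw [one_mul]; exact (h.nrm_map _).le⟩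

lemma tensorMap_ofTensor (h : TensorCompat γ f k) (t : X ⊗[ℂ] Y) :
    tensorMap h (X.ofTensor Y t) = X'.ofTensor Y' (TensorProduct.map f k t) :=
  complMap_coe (V := (X.preTensor Y).Space) (W := (X'.preTensor Y').Space) _ _ _

@[simp]
lemma tensorMap_tmul (h : TensorCompat γ f k) (x : X) (y : Y) :
    tensorMap h (X.tmul Y x y) = X'.tmul Y' (f x) (k y) :=
  tensorMap_ofTensor h _

/-- Continuous additive maps on the internal tensor product are determined by simple tensors. -/
lemma tensor_ext {W : Type*} [TopologicalSpace W] [T2Space W] [AddCommGroup W]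
    {F K : X.tensor Y → W} (hF : Continuous F) (hK : Continuous K)
    (hF' : ∀ s t, F (s + t) = F s + F t) (hK' : ∀ s t, K (s + t) = K s + K t)
    (h : ∀ x y, F (X.tmul Y x y) = K (X.tmul Y x y)) (t : X.tensor Y) : F t = K t := by
  refine congrFun (denseRange_ofTensor.equalizer hF hK (funext fun t => ?_)) t
  have h0 : ∀ {H : X.tensor Y → W}, (∀ s t, H (s + t) = H s + H t) → H 0 = 0 := by
    intro H hH
    simpa using hH 0 0
  change F (X.ofTensor Y t) = K (X.ofTensor Y t)
  induction t with
  | zero => rw [map_zero, h0 hF', h0 hK']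
  | add s s' h h' => rw [map_add, hF', hK', h, h']
  | tmul x y => exact h x y

lemma continuous_inner (Z : HilbertBimodule.{u, w} A B) {T : Type*} [TopologicalSpace T]
    {F K : T → Z} (hF : Continuous F) (hK : Continuous K) :
    Continuous fun t => Z.inner (F t) (K t) :=
  (PreHilbertModule.continuous_inner Z.isNorm).comp (hF.prodMk hK)

lemma continuous_lsmul (Z : HilbertBimodule.{u, w} A B) (a : A) : Continuous (Z.lsmul a) :=
  (LinearMap.mkContinuousOfExistsBound (Z.rep.lsmul a) (bound_lsmul Z.isNorm Z.rep a)).continuous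

lemma continuous_rsmul (Z : HilbertBimodule.{u, w} A B) (b : B) :
    Continuous (fun z => Z.rsmul z b) :=
  (LinearMap.mkContinuousOfExistsBound (Z.pre.rsmul (op b)) (bound_rsmul Z.isNorm _)).continuous

lemma inner_tensorMap (h : TensorCompat γ f k) (s t : X.tensor Y) :
    (X'.tensor Y').inner (tensorMap h s) (tensorMap h t) = γ ((X.tensor Y).inner s t) := by
  have hγ : Continuous γ := (StarAlgEquiv.isometry γ).continuous
  refine denseRange_ofTensor.induction_on₂ (p := fun s t =>
    (X'.tensor Y').inner (tensorMap h s) (tensorMap h t) = γ ((X.tensor Y).inner s t)) ?_ ?_ s t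
  · exact isClosed_eq
      (continuous_inner _ ((tensorMap h).continuous.comp continuous_fst)
        ((tensorMap h).continuous.comp continuous_snd))
      (hγ.comp (continuous_inner _ continuous_fst continuous_snd))
  · intro s t
    rw [tensorMap_ofTensor, tensorMap_ofTensor, inner_ofTensor, inner_ofTensor]
    exact h.inner_map s t

lemma tensorMap_lsmul (h : TensorCompat γ f k) {a a' : A}
    (ha : ∀ x, f (X.lsmul a x) = X'.lsmul a' (f x)) (t : X.tensor Y) :
    tensorMap h ((X.tensor Y).lsmul a t) = (X'.tensor Y').lsmul a' (tensorMap h t) := by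
  refine tensor_ext (F := fun t => tensorMap h ((X.tensor Y).lsmul a t))
    (K := fun t => (X'.tensor Y').lsmul a' (tensorMap h t))
    ((tensorMap h).continuous.comp (continuous_lsmul _ a))
    ((continuous_lsmul _ a').comp (tensorMap h).continuous)
    (by intros; simp only [map_add]) (by intros; simp only [map_add]) (fun x y => ?_) t
  rw [lsmul_tmul, tensorMap_tmul, tensorMap_tmul, lsmul_tmul, ha]

lemma tensorMap_rsmul (h : TensorCompat γ f k) {c c' : C}
    (hc : ∀ y, k (Y.rsmul y c) = Y'.rsmul (k y) c') (t : X.tensor Y) :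
    tensorMap h ((X.tensor Y).rsmul t c) = (X'.tensor Y').rsmul (tensorMap h t) c' := by
  refine tensor_ext (F := fun t => tensorMap h ((X.tensor Y).rsmul t c))
    (K := fun t => (X'.tensor Y').rsmul (tensorMap h t) c')
    ((tensorMap h).continuous.comp (continuous_rsmul _ c))
    ((continuous_rsmul _ c').comp (tensorMap h).continuous)
    (by intros; simp only [map_add]) (by intros; simp only [map_add]) (fun x y => ?_) t
  rw [rsmul_tmul, tensorMap_tmul, tensorMap_tmul, rsmul_tmul, hc]

/-- Two pairs of mutually inverse maps of the factors give mutually inverse maps. -/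
noncomputable def tensorEquiv {f : X ≃ₗ[ℂ] X'} {k : Y ≃ₗ[ℂ] Y'} {γ' : C ≃⋆ₐ[ℂ] C}
    (h : TensorCompat γ f.toLinearMap k.toLinearMap)
    (h' : TensorCompat γ' f.symm.toLinearMap k.symm.toLinearMap) :
    X.tensor Y ≃L[ℂ] X'.tensor Y' :=
  ContinuousLinearEquiv.equivOfInverse (tensorMap h) (tensorMap h')
    (tensor_ext (F := fun t => tensorMap h' (tensorMap h t))
      ((tensorMap h').continuous.comp (tensorMap h).continuous) continuous_id
      (by intros; simp) (by intros; simp) (by intros; simp))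
    (tensor_ext (F := fun t => tensorMap h (tensorMap h' t))
      ((tensorMap h).continuous.comp (tensorMap h').continuous) continuous_id
      (by intros; simp) (by intros; simp) (by intros; simp))

lemma tensorEquiv_apply {f : X ≃ₗ[ℂ] X'} {k : Y ≃ₗ[ℂ] Y'} {γ' : C ≃⋆ₐ[ℂ] C}
    (h : TensorCompat γ f.toLinearMap k.toLinearMap)
    (h' : TensorCompat γ' f.symm.toLinearMap k.symm.toLinearMap) (t : X.tensor Y) :
    tensorEquiv h h' t = tensorMap h t := rfl

@[simp]
lemma tensorEquiv_tmul {f : X ≃ₗ[ℂ] X'} {k : Y ≃ₗ[ℂ] Y'} {γ' : C ≃⋆ₐ[ℂ] C}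
    (h : TensorCompat γ f.toLinearMap k.toLinearMap)
    (h' : TensorCompat γ' f.symm.toLinearMap k.symm.toLinearMap) (x : X) (y : Y) :
    tensorEquiv h h' (X.tmul Y x y) = X'.tmul Y' (f x) (k y) :=
  tensorMap_tmul h x y

lemma Iso.tensorCompat (φ : Iso X X') (ψ : Iso Y Y') :
    TensorCompat (StarAlgEquiv.refl ℂ C) φ.toLinearEquiv.toLinearMap ψ.toLinearEquiv.toLinearMap := by
  intro x x' y y'
  have h1 := φ.inner_map x x'
  have h2 := ψ.map_lsmul (X.inner x x') y'
  have h3 := ψ.inner_map y (Y.lsmul (X.inner x x') y')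
  rw [h2, ← h1] at h3
  rw [h1] at h3
  change Y'.inner (ψ.toFun y) (Y'.lsmul (X'.inner (φ.toFun x) (φ.toFun x')) (ψ.toFun y')) = _
  rw [h1]
  exact h3

/-- The inverse isomorphism. -/
noncomputable def Iso.symm (φ : Iso X X') : Iso X' X where
  toLinearEquiv := φ.toLinearEquiv.symm
  map_lsmul a x := φ.toLinearEquiv.injective (by
    have := φ.map_lsmul a (φ.toLinearEquiv.symm x)
    refine (φ.toLinearEquiv.apply_symm_apply _).trans (Eq.trans ?_ this.symm)
    exact congrArg (X'.lsmul a) (φ.toLinearEquiv.apply_symm_apply x).symm)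
  map_rsmul x b := φ.toLinearEquiv.injective (by
    have := φ.map_rsmul (φ.toLinearEquiv.symm x) b
    refine (φ.toLinearEquiv.apply_symm_apply _).trans (Eq.trans ?_ this.symm)
    exact congrArg (X'.rsmul · b) (φ.toLinearEquiv.apply_symm_apply x).symm)
  inner_map x y := by
    refine (φ.inner_map _ _).symm.trans ?_
    exact congrArg₂ X'.inner (φ.toLinearEquiv.apply_symm_apply x)
      (φ.toLinearEquiv.apply_symm_apply y)

/-- Isomorphisms of the factors give an isomorphism of the internal tensor products. -/
noncomputable def Iso.tensor (φ : Iso X X') (ψ : Iso Y Y') : Iso (X.tensor Y) (X'.tensor Y') where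
  toLinearEquiv := (tensorEquiv (φ.tensorCompat ψ) (φ.symm.tensorCompat ψ.symm)).toLinearEquiv
  map_lsmul a := tensorMap_lsmul (φ.tensorCompat ψ) (fun x => φ.map_lsmul a x)
  map_rsmul t c := tensorMap_rsmul (φ.tensorCompat ψ) (fun y => ψ.map_rsmul y c) t
  inner_map := inner_tensorMap (φ.tensorCompat ψ)

lemma Iso.tensor_tmul (φ : Iso X X') (ψ : Iso Y Y') (x : X) (y : Y) :
    (φ.tensor ψ).toLinearEquiv (X.tmul Y x y) =
      X'.tmul Y' (φ.toLinearEquiv x) (ψ.toLinearEquiv y) :=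
  tensorMap_tmul (φ.tensorCompat ψ) x y

/-- The identity isomorphism. -/
noncomputable def Iso.refl (X : HilbertBimodule.{u, w} A B) : Iso X X where
  toLinearEquiv := LinearEquiv.refl ℂ X
  map_lsmul _ _ := rfl
  map_rsmul _ _ := rfl
  inner_map _ _ := rfl

/-- The composition of two isomorphisms. -/
noncomputable def Iso.trans {X'' : HilbertBimodule.{u, w} A B} (φ : Iso X X') (ψ : Iso X' X'') :
    Iso X X'' where
  toLinearEquiv := φ.toLinearEquiv.trans ψ.toLinearEquiv
  map_lsmul a x := (congrArg ψ.toFun (φ.map_lsmul a x)).trans (ψ.map_lsmul a _)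
  map_rsmul x b := (congrArg ψ.toFun (φ.map_rsmul x b)).trans (ψ.map_rsmul _ b)
  inner_map x y := (ψ.inner_map _ _).trans (φ.inner_map x y)

end Tensor

end HilbertBimodule

section Systems

variable {A B C : Type u} {G : Type v} [Group G] [CStarAlgebra A]
  [CStarAlgebra B] [PartialOrder B] [StarOrderedRing B]
  [CStarAlgebra C] [PartialOrder C] [StarOrderedRing C]

/-- A twisted unital discrete `C⋆`-dynamical system `(A, G, α, σ)`. -/
structure TwistedSystem (A : Type u) (G : Type v) [CStarAlgebra A] [Group G] where
  α : G → A ≃⋆ₐ[ℂ] A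
  σ : G → G → unitary A
  α_α : ∀ g h a, α g (α h a) = σ g h * α (g * h) a * star (σ g h : A)
  cocycle : ∀ g h k, (σ g h * σ (g * h) k : A) = α g (σ h k) * σ g (h * k)
  σ_one_right : ∀ g, σ g 1 = 1
  σ_one_left : ∀ g, σ 1 g = 1

open HilbertBimodule

/-- `δ : G → I(Z)` is a `(Σ, Θ)`-compatible action on the right Hilbert `A`-`B`-bimodule `Z`, where
`I(Z)` is the group of bounded invertible `ℂ`-linear maps. -/
structure IsCompatibleAction (S : TwistedSystem A G) (T : TwistedSystem B G)
    (Z : HilbertBimodule.{u, w} A B) (δ : G → Z ≃L[ℂ] Z) : Prop where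
  map_lsmul : ∀ g a z, δ g (Z.lsmul a z) = Z.lsmul (S.α g a) (δ g z)
  map_rsmul : ∀ g z b, δ g (Z.rsmul z b) = Z.rsmul (δ g z) (T.α g b)
  mul_apply : ∀ g h z, δ g (δ h z) =
    Z.rsmul (Z.lsmul (S.σ g h) (δ (g * h) z)) (star (T.σ g h : B))
  inner_map : ∀ g z z', Z.inner (δ g z) (δ g z') = T.α g (Z.inner z z')

/-- A pair `(Z, δ)` of a right Hilbert `A`-`B`-bimodule with a `(Σ, Θ)`-compatible action. -/
structure CompatibleBimodule (S : TwistedSystem A G) (T : TwistedSystem B G) where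
  mod : HilbertBimodule.{u, w} A B
  act : G → mod ≃L[ℂ] mod
  compat : IsCompatibleAction S T mod act

namespace HilbertBimodule

variable {X : HilbertBimodule.{u, w} A B} {Y : HilbertBimodule.{u, w} B C}

lemma inner_add_left (Z : HilbertBimodule.{u, w} A B) (x y z : Z) :
    Z.inner (x + y) z = Z.inner x z + Z.inner y z :=
  congrArg (fun f => f z) (map_add Z.pre.inner x y)

lemma tmul_middle (b : B) (x : X) (y : Y) :
    X.tmul Y (X.rsmul x b) y = X.tmul Y x (Y.lsmul b y) := by
  refine (X.tensor Y).ext_inner fun t => ?_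
  refine tensor_ext
    (F := fun t => star ((X.tensor Y).inner t (X.tmul Y (X.rsmul x b) y)))
    (K := fun t => star ((X.tensor Y).inner t (X.tmul Y x (Y.lsmul b y)))) ?_ ?_ ?_ ?_ ?_ t |>
      star_injective
  · exact (HilbertBimodule.continuous_inner _ continuous_id continuous_const).star
  · exact (HilbertBimodule.continuous_inner _ continuous_id continuous_const).star
  · intro s t; exact (congrArg star (inner_add_left _ _ _ _)).trans (star_add _ _)
  · intro s t; exact (congrArg star (inner_add_left _ _ _ _)).trans (star_add _ _)
  · intro x' y'
    rw [inner_tmul, inner_tmul]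
    refine congrArg star (congrArg (Y.inner y') ?_)
    refine Eq.trans (congrArg (Y.lsmul · y) (X.pre.inner_rsmul x' x b)) ?_
    exact congrArg (fun f => f y) (map_mul Y.rep.lsmul _ _)

lemma rsmul_rsmul (x : X) (b c : B) : X.rsmul (X.rsmul x b) c = X.rsmul x (b * c) := by
  have := map_mul X.pre.rsmul (op c) (op b)
  exact (congrArg (fun f => f x) this).symm

lemma rsmul_one (x : X) : X.rsmul x 1 = x :=
  congrArg (fun f => f x) (map_one X.pre.rsmul)

lemma lsmul_lsmul (x : X) (a b : A) : X.lsmul a (X.lsmul b x) = X.lsmul (a * b) x :=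
  (congrArg (fun f => f x) (map_mul X.rep.lsmul a b)).symm

lemma lsmul_one (x : X) : X.lsmul 1 x = x :=
  congrArg (fun f => f x) (map_one X.rep.lsmul)

end HilbertBimodule

namespace IsCompatibleAction

variable {S : TwistedSystem A G} {T : TwistedSystem B G} {R : TwistedSystem C G}
  {X : HilbertBimodule.{u, w} A B} {Y : HilbertBimodule.{u, w} B C}
  {δ : G → X ≃L[ℂ] X} {η : G → Y ≃L[ℂ] Y}

lemma tensorCompat (hδ : IsCompatibleAction S T X δ) (hη : IsCompatibleAction T R Y η) (g : G) :
    TensorCompat (R.α g) (δ g).toLinearEquiv.toLinearMap (η g).toLinearEquiv.toLinearMap := by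
  intro x x' y y'
  change Y.inner (η g y) (Y.lsmul (X.inner (δ g x) (δ g x')) (η g y')) = _
  rw [hδ.inner_map, ← hη.map_lsmul, hη.inner_map]

lemma tensorCompat_symm (hδ : IsCompatibleAction S T X δ) (hη : IsCompatibleAction T R Y η)
    (g : G) : TensorCompat (R.α g).symm (δ g).toLinearEquiv.symm.toLinearMap
      (η g).toLinearEquiv.symm.toLinearMap := by
  intro x x' y y'
  have hinj : Function.Injective (R.α g) := (R.α g).injective
  refine hinj ?_
  rw [StarAlgEquiv.apply_symm_apply]
  have h := hδ.tensorCompat hη g ((δ g).symm x) ((δ g).symm x') ((η g).symm y) ((η g).symm y')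
  refine h.symm.trans ?_
  change Y.inner (η g ((η g).symm y)) (Y.lsmul (X.inner (δ g ((δ g).symm x))
    (δ g ((δ g).symm x'))) (η g ((η g).symm y'))) = _
  simp only [ContinuousLinearEquiv.apply_symm_apply]

/-- The product action `δ ⊗ η`, determined by `(δ ⊗ η)(g)(x ⊗ y) = δ(g) x ⊗ η(g) y`. -/
noncomputable def tensorAct (hδ : IsCompatibleAction S T X δ) (hη : IsCompatibleAction T R Y η)
    (g : G) : X.tensor Y ≃L[ℂ] X.tensor Y :=
  tensorEquiv (hδ.tensorCompat hη g) (hδ.tensorCompat_symm hη g)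

lemma tensorAct_tmul (hδ : IsCompatibleAction S T X δ) (hη : IsCompatibleAction T R Y η)
    (g : G) (x : X) (y : Y) :
    hδ.tensorAct hη g (X.tmul Y x y) = X.tmul Y (δ g x) (η g y) :=
  tensorMap_tmul (hδ.tensorCompat hη g) x y

lemma tensor (hδ : IsCompatibleAction S T X δ) (hη : IsCompatibleAction T R Y η) :
    IsCompatibleAction S R (X.tensor Y) (hδ.tensorAct hη) where
  map_lsmul g a := tensorMap_lsmul (hδ.tensorCompat hη g) (hδ.map_lsmul g a)
  map_rsmul g t c := tensorMap_rsmul (hδ.tensorCompat hη g) (fun y => hη.map_rsmul g y c) t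
  inner_map g := inner_tensorMap (hδ.tensorCompat hη g)
  mul_apply g h t := by
    refine tensor_ext (F := fun t => hδ.tensorAct hη g (hδ.tensorAct hη h t))
      (K := fun t => (X.tensor Y).rsmul ((X.tensor Y).lsmul (S.σ g h)
        (hδ.tensorAct hη (g * h) t)) (star (R.σ g h : C)))
      ((hδ.tensorAct hη g).continuous.comp (hδ.tensorAct hη h).continuous)
      ((continuous_rsmul _ _).comp
        ((continuous_lsmul _ _).comp (hδ.tensorAct hη (g * h)).continuous))
      (by intros; simp only [map_add]) (by intros; simp only [map_add]) (fun x y => ?_) t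
    simp only [tensorAct_tmul]
    rw [lsmul_tmul, rsmul_tmul, hδ.mul_apply, hη.mul_apply, tmul_middle, ← lsmul_rsmul,
      lsmul_lsmul, Unitary.coe_star_mul_self, lsmul_one]

end IsCompatibleAction

namespace CompatibleBimodule

variable {S : TwistedSystem A G} {T : TwistedSystem B G} {R : TwistedSystem C G}

/-- The pair `(X ⊗_B Y, δ ⊗_B η)`. -/
noncomputable def tensor (P : CompatibleBimodule.{u, v, w} S T)
    (Q : CompatibleBimodule.{u, v, w} T R) : CompatibleBimodule.{u, v, w} S R where
  mod := P.mod.tensor Q.mod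
  act := P.compat.tensorAct Q.compat
  compat := P.compat.tensor Q.compat

/-- The simple tensor `x ⊗ y` in `X ⊗_B Y`. -/
noncomputable def tmul (P : CompatibleBimodule.{u, v, w} S T)
    (Q : CompatibleBimodule.{u, v, w} T R) (x : P.mod) (y : Q.mod) : (P.tensor Q).mod :=
  P.mod.tmul Q.mod x y

/-- Equivariant isomorphism: an isomorphism of right Hilbert bimodules intertwining the actions. -/
def EquivIso (P Q : CompatibleBimodule.{u, v, w} S T) : Prop :=
  ∃ φ : Iso P.mod Q.mod, ∀ g x, φ.toLinearEquiv (P.act g x) = Q.act g (φ.toLinearEquiv x)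

lemma EquivIso.refl (P : CompatibleBimodule.{u, v, w} S T) : EquivIso P P :=
  ⟨Iso.refl P.mod, fun _ _ => rfl⟩

lemma EquivIso.symm {P Q : CompatibleBimodule.{u, v, w} S T} : EquivIso P Q → EquivIso Q P := by
  rintro ⟨φ, h⟩
  refine ⟨φ.symm, fun g x => φ.toLinearEquiv.injective ?_⟩
  refine (φ.toLinearEquiv.apply_symm_apply _).trans ?_
  exact (congrArg (Q.act g) (φ.toLinearEquiv.apply_symm_apply x)).symm.trans (h g _).symm

lemma EquivIso.trans {P Q W : CompatibleBimodule.{u, v, w} S T} :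
    EquivIso P Q → EquivIso Q W → EquivIso P W := by
  rintro ⟨φ, h⟩ ⟨ψ, h'⟩
  exact ⟨φ.trans ψ, fun g x => (congrArg ψ.toLinearEquiv (h g x)).trans (h' g _)⟩

lemma EquivIso.tensor {P P' : CompatibleBimodule.{u, v, w} S T}
    {Q Q' : CompatibleBimodule.{u, v, w} T R} :
    EquivIso P P' → EquivIso Q Q' → EquivIso (P.tensor Q) (P'.tensor Q') := by
  rintro ⟨φ, h⟩ ⟨ψ, h'⟩
  refine ⟨φ.tensor ψ, fun g t => ?_⟩
  have hφ : Continuous (φ.tensor ψ).toLinearEquiv :=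
    (tensorMap (φ.tensorCompat ψ)).continuous
  refine tensor_ext (F := fun t => (φ.tensor ψ).toLinearEquiv (P.compat.tensorAct Q.compat g t))
    (K := fun t => P'.compat.tensorAct Q'.compat g ((φ.tensor ψ).toLinearEquiv t))
    (hφ.comp (P.compat.tensorAct Q.compat g).continuous)
    ((P'.compat.tensorAct Q'.compat g).continuous.comp hφ)
    (by intros; simp only [map_add]) (by intros; simp only [map_add]) (fun x y => ?_) t
  rw [Iso.tensor_tmul]
  refine (congrArg _ (P.compat.tensorAct_tmul Q.compat g x y)).trans ?_
  refine ((φ.tensor_tmul ψ _ _)).trans ?_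
  rw [h, h']
  exact (P'.compat.tensorAct_tmul Q'.compat g _ _).symm

instance setoid (S : TwistedSystem A G) (T : TwistedSystem B G) :
    Setoid (CompatibleBimodule.{u, v, w} S T) where
  r := EquivIso
  iseqv := ⟨EquivIso.refl, EquivIso.symm, EquivIso.trans⟩

end CompatibleBimodule

end Systems

section Morita

open HilbertBimodule

variable {A B : Type u} {G : Type v} [Group G]
  [CStarAlgebra A] [PartialOrder A] [StarOrderedRing A]
  [CStarAlgebra B] [PartialOrder B] [StarOrderedRing B]

/-- `A` as a right Hilbert `A`-`A`-bimodule, with `⟨a, b⟩ = a⋆ b`. -/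
noncomputable def HilbertBimodule.self (A : Type u) [CStarAlgebra A] [PartialOrder A]
    [StarOrderedRing A] : HilbertBimodule.{u, u} A A where
  carrier := A
  pre :=
    { rsmul := Algebra.lsmul ℂ ℂ A
      inner := LinearMap.mk₂'ₛₗ (starRingEnd ℂ) (RingHom.id ℂ) (fun a b => star a * b)
        (by intros; simp [add_mul]) (by intros; simp) (by intros; simp [mul_add])
        (by intros; simp)
      inner_rsmul := by intros; simp [mul_assoc]
      star_inner := by intros; simp
      inner_self_nonneg := by intro x; exact star_mul_self_nonneg x }
  isNorm x := by
    simp [CStarRing.norm_star_mul_self]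
  rep :=
    { lsmul := Algebra.lsmul ℂ ℂ A
      inner_lsmul := by intros; simp [mul_assoc] }

/-- The `(Σ, Σ)`-compatible action `α` on `A`. -/
noncomputable def CompatibleBimodule.one (S : TwistedSystem A G) :
    CompatibleBimodule.{u, v, u} S S where
  mod := HilbertBimodule.self A
  act g := (LinearIsometryEquiv.mk (S.α g).toAlgEquiv.toLinearEquiv
    (fun a => StarAlgEquiv.norm_map (S.α g) a)).toContinuousLinearEquiv
  compat :=
    { map_lsmul := fun g (a z : A) => map_mul (S.α g) a z
      map_rsmul := fun g (z b : A) => map_mul (S.α g) z b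
      mul_apply := fun g h (z : A) => S.α_α g h z
      inner_map := fun g (z z' : A) => by
        change star (S.α g z) * S.α g z' = S.α g (star z * z')
        rw [map_mul, map_star] }

/-- The collection `𝒜(Σ)` of equivariant isomorphism classes
`[X, v]` of `(Σ, Σ)`-compatible actions. -/
def ActionClass (S : TwistedSystem A G) : Type (max u v (w + 1)) :=
  Quotient (CompatibleBimodule.setoid.{u, v, w} S S)

namespace ActionClass

/-- The class `[X, v]`. -/
def mk {S : TwistedSystem A G} (P : CompatibleBimodule.{u, v, w} S S) : ActionClass.{u, v, w} S :=
  Quotient.mk _ P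

noncomputable instance (S : TwistedSystem A G) : Mul (ActionClass.{u, v, w} S) :=
  ⟨Quotient.map₂ CompatibleBimodule.tensor fun _ _ h _ _ h' => h.tensor h'⟩

noncomputable instance (S : TwistedSystem A G) : One (ActionClass.{u, v, u} S) :=
  ⟨mk (CompatibleBimodule.one S)⟩

end ActionClass

/-- An `A`-`B` imprimitivity bimodule: a full right Hilbert `A`-`B`-bimodule which is also a full
left Hilbert `A`-`B`-bimodule, such that `_A⟨x, y⟩ z = x ⟨y, z⟩_B`. The norms of the two inner
products automatically coincide, so that completeness for the left one need not be stated. -/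
structure ImprimitivityBimodule (A B : Type u) [CStarAlgebra A] [PartialOrder A]
    [StarOrderedRing A] [CStarAlgebra B] [PartialOrder B] [StarOrderedRing B]
    extends HilbertBimodule.{u, w} A B where
  /-- The `A`-valued inner product, linear in the first variable. -/
  leftInner : carrier →ₗ[ℂ] carrier →ₗ⋆[ℂ] A
  leftInner_lsmul : ∀ a x y, leftInner (rep.lsmul a x) y = a * leftInner x y
  star_leftInner : ∀ x y, star (leftInner x y) = leftInner y x
  leftInner_self_nonneg : ∀ x, 0 ≤ leftInner x x
  leftInner_self_eq_zero : ∀ x, leftInner x x = 0 → x = 0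
  /-- `B` acts on the right by adjointable operators of the left Hilbert module. -/
  leftInner_rsmul : ∀ b x y,
    leftInner (pre.rsmul (op b) x) y = leftInner x (pre.rsmul (op (star b)) y)
  leftInner_smul_eq : ∀ x y z, rep.lsmul (leftInner x y) z = pre.rsmul (op (pre.inner y z)) x
  full_right : Dense (Submodule.span ℂ {b | ∃ x y, pre.inner x y = b} : Set B)
  full_left : Dense (Submodule.span ℂ {a | ∃ x y, leftInner x y = a} : Set A)

instance : CoeSort (ImprimitivityBimodule.{u, w} A B) (Type w) := ⟨fun Z => Z.carrier⟩

/-- The conjugate of a complex vector space `E`: same addition and norm, conjugate scalars. -/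
def ConjSpace (E : Type w) : Type w := E

namespace ConjSpace

variable {E : Type w} [NormedAddCommGroup E] [NormedSpace ℂ E]

instance : NormedAddCommGroup (ConjSpace E) := inferInstanceAs (NormedAddCommGroup E)

instance [CompleteSpace E] : CompleteSpace (ConjSpace E) := inferInstanceAs (CompleteSpace E)

noncomputable instance : Module ℂ (ConjSpace E) :=
  Module.compHom E (starRingEnd ℂ)

/-- The conjugate linear bijection `z ↦ z̃`. -/
noncomputable def conj : E ≃ₛₗ[starRingEnd ℂ] ConjSpace E where
  toFun x := x
  invFun x := x
  map_add' _ _ := rfl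
  map_smul' c x := by
    change c • x = (starRingEnd ℂ (starRingEnd ℂ c)) • x
    simp
  left_inv _ := rfl
  right_inv _ := rfl

@[simp]
lemma conj_symm_add (x y : ConjSpace E) : conj.symm (x + y) = conj.symm x + conj.symm y := rfl

@[simp]
lemma conj_symm_smul (c : ℂ) (x : ConjSpace E) :
    conj.symm (c • x) = starRingEnd ℂ c • conj.symm x := rfl

@[simp]
lemma conj_smul (c : ℂ) (x : E) :
    conj (starRingEnd ℂ c • x) = c • conj x := by
  rw [map_smulₛₗ, Complex.conj_conj]

lemma norm_conj (x : E) : ‖(conj x : ConjSpace E)‖ = ‖x‖ := rfl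

noncomputable instance : NormedSpace ℂ (ConjSpace E) where
  norm_smul_le c x := by
    obtain ⟨x, rfl⟩ := conj.surjective x
    have : c • conj x = conj (starRingEnd ℂ c • x) := by
      rw [map_smulₛₗ, Complex.conj_conj]
    rw [this, norm_conj, norm_conj, norm_smul]
    simp

end ConjSpace

namespace ImprimitivityBimodule

open ConjSpace PreHilbertModule

variable (Z : ImprimitivityBimodule.{u, w} A B)

/-- The conjugate module `Z̃` as a semi-inner product `A`-module: `z̃ · a = (a⋆ · z)~` and
`⟨z̃, w̃⟩ = _A⟨z, w⟩`. -/
noncomputable def conjPre : PreHilbertModule A (ConjSpace Z) where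
  rsmul := AlgHom.ofLinearMap
    { toFun := fun a =>
        { toFun := fun z => conj (Z.rep.lsmul (star (unop a)) (conj.symm z))
          map_add' := by intros; simp only [map_add]
          map_smul' := by intros; simp only [map_smulₛₗ, Complex.conj_conj, RingHom.id_apply] }
      map_add' := by intros; ext; simp
      map_smul' := by intros; ext; simp }
    (by ext; simp)
    (by intros; ext; simp)
  inner := LinearMap.mk₂'ₛₗ (starRingEnd ℂ) (RingHom.id ℂ)
    (fun z w => Z.leftInner (conj.symm z) (conj.symm w))
    (by intros; simp) (by intros; simp) (by intros; simp) (by intros; simp)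
  inner_rsmul z w a := by
    rw [← star_inj]
    simp [Z.star_leftInner, Z.leftInner_lsmul]
  star_inner z w := by simp [Z.star_leftInner]
  inner_self_nonneg z := by simpa using Z.leftInner_self_nonneg _

/-- The left action of `B` on the conjugate module: `b · z̃ = (z · b⋆)~`. -/
noncomputable def conjRep : Z.conjPre.Rep B where
  lsmul := AlgHom.ofLinearMap
    { toFun := fun b =>
        { toFun := fun z => conj (Z.pre.rsmul (op (star b)) (conj.symm z))
          map_add' := by intros; simp only [map_add]
          map_smul' := by intros; simp only [map_smulₛₗ, Complex.conj_conj, RingHom.id_apply] }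
      map_add' := by intros; ext; simp
      map_smul' := by intros; ext; simp }
    (by ext; simp)
    (by intros; ext; simp)
  inner_lsmul b z w := by
    change Z.leftInner (Z.pre.rsmul (op (star b)) _) _ =
      Z.leftInner _ (Z.pre.rsmul (op (star (star b))) _)
    exact Z.leftInner_rsmul _ _ _

lemma leftInner_rsmul' (x : Z) (b : B) (y : Z) :
    Z.leftInner (Z.rsmul x b) y = Z.leftInner x (Z.rsmul y (star b)) :=
  Z.leftInner_rsmul b x y

lemma norm_leftInner (z : Z) : ‖Z.leftInner z z‖ = ‖Z.inner z z‖ := by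
  set L := Z.leftInner z z with hL
  set R := Z.inner z z with hR
  have hLs : star L = L := Z.star_leftInner z z
  have hRs : star R = R := Z.pre.star_inner z z
  have hlink : Z.lsmul L z = Z.rsmul z R := Z.leftInner_smul_eq z z z
  have h1 : ‖L‖ * ‖L‖ ≤ ‖R‖ * ‖L‖ := by
    have e1 : L * L = Z.conjPre.inner (Z.conjRep.lsmul R (conj z)) (conj z) := by
      change L * L = Z.leftInner (Z.rsmul z (star R)) z
      rw [hRs, ← hlink]
      exact (Z.leftInner_lsmul L z z).symm
    have e2 : ‖L * L‖ = ‖L‖ * ‖L‖ := by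
      conv_lhs => rw [← hLs, hLs]
      nth_rewrite 1 [← hLs]
      exact CStarRing.norm_star_mul_self
    have e3 : Z.conjPre.nrm (conj z) ^ 2 = ‖L‖ := Z.conjPre.nrm_sq (conj z)
    rw [← e2, e1, ← e3]
    have e4 := Z.conjPre.norm_inner_le (Z.conjRep.lsmul R (conj z)) (conj z)
    have e5 := Z.conjPre.nrm_lsmul_le Z.conjRep R (conj z)
    have e6 := Z.conjPre.nrm_nonneg (conj z)
    nlinarith
  have h2 : ‖R‖ * ‖R‖ ≤ ‖L‖ * ‖R‖ := by
    have e1 : R * R = Z.pre.inner z (Z.rep.lsmul L z) := by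
      refine Eq.trans ?_ (congrArg (Z.pre.inner z) hlink).symm
      exact (Z.pre.inner_rsmul z z R).symm
    have e2 : ‖R * R‖ = ‖R‖ * ‖R‖ := by
      nth_rewrite 1 [← hRs]
      exact CStarRing.norm_star_mul_self
    have e3 : Z.pre.nrm z ^ 2 = ‖R‖ := Z.pre.nrm_sq z
    rw [← e2, e1, ← e3]
    have e4 := Z.pre.norm_inner_le z (Z.rep.lsmul L z)
    have e5 := Z.pre.nrm_lsmul_le Z.rep L z
    have e6 := Z.pre.nrm_nonneg z
    nlinarith
  rcases (norm_nonneg L).eq_or_lt with hL0 | hL0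
  · rw [← hL0, zero_mul] at h2
    have := norm_nonneg R
    nlinarith
  · rcases (norm_nonneg R).eq_or_lt with hR0 | hR0
    · rw [← hR0, zero_mul] at h1
      nlinarith
    · exact le_antisymm (le_of_mul_le_mul_right h1 hL0) (le_of_mul_le_mul_right h2 hR0)

/-- The conjugate right Hilbert `B`-`A`-bimodule `Z̃`, with `b · z̃ · a = (a⋆ · z · b⋆)~` and
`⟨z̃, w̃⟩_A = _A⟨z, w⟩`. -/
noncomputable def conjugate : HilbertBimodule.{u, w} B A where
  carrier := ConjSpace Z
  pre := Z.conjPre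
  isNorm z := by
    change ‖(ConjSpace.conj.symm z : Z)‖ =
      √‖Z.leftInner (ConjSpace.conj.symm z) (ConjSpace.conj.symm z)‖
    rw [norm_leftInner]
    exact Z.isNorm _
  rep := Z.conjRep

end ImprimitivityBimodule

/-- A Morita equivalence `(Z, δ)` of the systems `Σ` and `Θ`: an `A`-`B` imprimitivity bimodule `Z`
with a `(Σ, Θ)`-compatible action `δ` of `G`. -/
structure SystemMoritaEquivalence (S : TwistedSystem A G) (T : TwistedSystem B G) where
  bimod : ImprimitivityBimodule.{u, w} A B
  act : G → bimod ≃L[ℂ] bimod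
  compat : IsCompatibleAction S T bimod.toHilbertBimodule act

namespace SystemMoritaEquivalence

open ConjSpace

variable {S : TwistedSystem A G} {T : TwistedSystem B G} (M : SystemMoritaEquivalence.{u, v, w} S T)

/-- The pair `(Z, δ)`. -/
noncomputable def toCompatibleBimodule : CompatibleBimodule.{u, v, w} S T where
  mod := M.bimod.toHilbertBimodule
  act := M.act
  compat := M.compat

lemma eq_zero_of_lsmul {a : A} (h : ∀ z, M.bimod.lsmul a z = 0) : a = 0 := by
  have h1 : ∀ c ∈ (Submodule.span ℂ {c | ∃ x y, M.bimod.leftInner x y = c} : Set A), a * c = 0 := by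
    intro c hc
    induction hc using Submodule.span_induction with
    | mem c hc =>
      obtain ⟨x, y, rfl⟩ := hc
      refine (M.bimod.leftInner_lsmul a x y).symm.trans ?_
      refine (congrArg (fun z => M.bimod.leftInner z y) (h x)).trans ?_
      simp
    | zero => simp
    | add x y _ _ hx hy => rw [mul_add, hx, hy, add_zero]
    | smul c x _ hx => rw [mul_smul_comm, hx, smul_zero]
  have h2 : ∀ c : A, a * c = 0 := fun c =>
    congrFun (Continuous.ext_on M.bimod.full_left (continuous_const_mul a) continuous_const h1) c
  simpa using h2 1

lemma leftInner_act (g : G) (z w : M.bimod) :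
    M.bimod.leftInner (M.act g z) (M.act g w) = S.α g (M.bimod.leftInner z w) := by
  rw [← sub_eq_zero]
  refine M.eq_zero_of_lsmul fun x => ?_
  obtain ⟨x, rfl⟩ := (M.act g).surjective x
  refine (congrArg (fun f => f (M.act g x)) (map_sub M.bimod.rep.lsmul _ _)).trans ?_
  rw [LinearMap.sub_apply, sub_eq_zero]
  refine (M.bimod.leftInner_smul_eq _ _ _).trans ?_
  refine Eq.trans ?_ (M.compat.map_lsmul g _ x)
  refine Eq.trans ?_ (congrArg (M.act g) (M.bimod.leftInner_smul_eq z w x)).symm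
  refine Eq.trans ?_ (M.compat.map_rsmul g z _).symm
  exact congrArg (M.bimod.rsmul (M.act g z)) (M.compat.inner_map g w x)

/-- The action `δ̃(g) z̃ = (δ(g) z)~` on the conjugate bimodule. -/
noncomputable def conjAct (g : G) : M.bimod.conjugate ≃L[ℂ] M.bimod.conjugate :=
  { toFun := fun z => (conj (M.act g (conj.symm z)) : ConjSpace M.bimod)
    invFun := fun z => (conj ((M.act g).symm (conj.symm z)) : ConjSpace M.bimod)
    map_add' := fun z w => congrArg conj
      ((M.act g).map_add (conj.symm z : M.bimod) (conj.symm w : M.bimod))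
    map_smul' := fun c z => congrArg conj
      ((M.act g).map_smul (starRingEnd ℂ c) (conj.symm z : M.bimod))
    left_inv := fun z => (M.act g).symm_apply_apply (conj.symm z)
    right_inv := fun z => (M.act g).apply_symm_apply (conj.symm z)
    continuous_toFun := (M.act g).continuous
    continuous_invFun := (M.act g).symm.continuous }

/-- The pair `(Z̃, δ̃)`. -/
noncomputable def conjugate : CompatibleBimodule.{u, v, w} T S where
  mod := M.bimod.conjugate
  act := M.conjAct
  compat :=
    { map_lsmul := fun g b z => by
        refine (M.compat.map_rsmul g (conj.symm z) (star b)).trans ?_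
        rw [map_star]
        rfl
      map_rsmul := fun g z a => by
        refine (M.compat.map_lsmul g (star a) (conj.symm z)).trans ?_
        rw [map_star]
        rfl
      mul_apply := fun g h z => by
        refine (M.compat.mul_apply g h (conj.symm z)).trans ?_
        rw [← lsmul_rsmul]
        change _ = M.bimod.lsmul (star (star (S.σ g h : A)))
          (M.bimod.rsmul (M.act (g * h) (conj.symm z)) (star (T.σ g h : B)))
        rw [star_star]
      inner_map := fun g z w => M.leftInner_act g (conj.symm z) (conj.symm w) }

/-- The element `z̃` of the conjugate bimodule. -/
noncomputable def tilde (z : M.bimod) : M.conjugate.mod := (conj z : ConjSpace M.bimod)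

lemma conjugate_act_tilde (g : G) (z : M.bimod) :
    M.conjugate.act g (M.tilde z) = M.tilde (M.act g z) :=
  rfl

end SystemMoritaEquivalence

/-- An equivariant representation `(ρ, v)` of `Σ` on a right Hilbert `A`-module `X`. -/
structure EquivariantRep (S : TwistedSystem A G) where
  X : HilbertModule.{u, w} A
  ρ : X.pre.Rep A
  v : G → X ≃L[ℂ] X
  ρ_α : ∀ g a x, ρ.lsmul (S.α g a) x = v g (ρ.lsmul a ((v g).symm x))
  v_mul : ∀ g h x, v g (v h x) =
    X.rsmul (ρ.lsmul (S.σ g h) (v (g * h) x)) (star (S.σ g h : A))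
  inner_v : ∀ g x x', S.α g (X.inner x x') = X.inner (v g x) (v g x')
  v_rsmul : ∀ g x a, v g (X.rsmul x a) = X.rsmul (v g x) (S.α g a)

namespace EquivariantRep

variable {S : TwistedSystem A G}

/-- An equivariant representation of `Σ` as a `(Σ, Σ)`-compatible action. -/
noncomputable def toCompatibleBimodule (R : EquivariantRep.{u, v, w} S) :
    CompatibleBimodule.{u, v, w} S S where
  mod := { R.X with rep := R.ρ }
  act := R.v
  compat :=
    { map_lsmul := fun g a z => by
        have h := R.ρ_α g a (R.v g z)
        rw [ContinuousLinearEquiv.symm_apply_apply] at h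
        exact h.symm
      map_rsmul := R.v_rsmul
      mul_apply := R.v_mul
      inner_map := fun g z z' => (R.inner_v g z z').symm }

/-- A `(Σ, Σ)`-compatible action as an equivariant representation of `Σ`. -/
noncomputable def ofCompatibleBimodule (P : CompatibleBimodule.{u, v, w} S S) :
    EquivariantRep.{u, v, w} S where
  X := P.mod.toHilbertModule
  ρ := P.mod.rep
  v := P.act
  ρ_α g a x := by
    have h := P.compat.map_lsmul g a ((P.act g).symm x)
    rw [ContinuousLinearEquiv.apply_symm_apply] at h
    exact h.symm
  v_mul := P.compat.mul_apply
  inner_v g x x' := (P.compat.inner_map g x x').symm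
  v_rsmul := P.compat.map_rsmul

/-- Isomorphism of equivariant representations: an isomorphism of right Hilbert `A`-modules which
intertwines the representations of `A` and the actions of `G`. -/
def IsoRel (R R' : EquivariantRep.{u, v, w} S) : Prop :=
  ∃ φ : R.X ≃ₗ[ℂ] R'.X,
    (∀ x a, φ (R.X.rsmul x a) = R'.X.rsmul (φ x) a) ∧
    (∀ x y, R'.X.inner (φ x) (φ y) = R.X.inner x y) ∧
    (∀ a x, φ (R.ρ.lsmul a x) = R'.ρ.lsmul a (φ x)) ∧
    ∀ g x, φ (R.v g x) = R'.v g (φ x)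

lemma isoRel_iff (R R' : EquivariantRep.{u, v, w} S) :
    IsoRel R R' ↔ CompatibleBimodule.EquivIso R.toCompatibleBimodule R'.toCompatibleBimodule :=
  ⟨fun ⟨φ, h1, h2, h3, h4⟩ => ⟨⟨φ, h3, h1, h2⟩, h4⟩,
    fun ⟨φ, h⟩ => ⟨φ.toLinearEquiv, φ.map_rsmul, φ.inner_map, φ.map_lsmul, h⟩⟩

instance setoid (S : TwistedSystem A G) : Setoid (EquivariantRep.{u, v, w} S) where
  r := IsoRel
  iseqv :=
    ⟨fun R => (isoRel_iff R R).2 (.refl _),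
      fun {R R'} h => (isoRel_iff R' R).2 ((isoRel_iff R R').1 h).symm,
      fun {R R' R''} h h' =>
        (isoRel_iff R R'').2 (((isoRel_iff R R').1 h).trans ((isoRel_iff R' R'').1 h'))⟩

end EquivariantRep

/-- The collection of isomorphism classes of equivariant representations of `Σ`. -/
def EquivariantRepClass (S : TwistedSystem A G) : Type (max u v (w + 1)) :=
  Quotient (EquivariantRep.setoid.{u, v, w} S)

/-- The isomorphism class of an equivariant representation. -/
def EquivariantRepClass.mk {S : TwistedSystem A G} (R : EquivariantRep.{u, v, w} S) :
    EquivariantRepClass.{u, v, w} S :=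
  Quotient.mk _ R

end Morita

end CStarMorita

open CStarMorita

universe u v

universe w

/-! Tensoring with a Morita equivalence `(Z, δ)` is invertible. Compatible actions compose like
arrows between systems: the internal tensor product is associative up to equivariant isomorphism,
and `(A, α)` is a two-sided unit. The imprimitivity structure makes `(Z̃, δ̃)` an inverse of `(Z,
δ)`: the two inner products give equivariant isomorphisms `Z̃ ⊗_A Z ≅ B` and `Z ⊗_B Z̃ ≅ A`
(`equivIso_conjugate_tensor`, `equivIso_tensor_conjugate`). Then `X ↦ (Z̃ ⊗ X) ⊗ Z` is conjugation
by an invertible arrow, so it has the inverse `Y ↦ Z ⊗ (Y ⊗ Z̃)` and respects products and units.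
All of this is formal manipulation of `assoc`, `one_tensor`, `tensor_one` and these two
isomorphisms.

All the analysis sits in one criterion, `EquivIso.of_dense`. Suppose two Hilbert bimodules carry
families over the same index set with dense linear spans and the same Gram matrix. Then matching the
families extends to a surjective isometry (`exists_unitary`). Right linearity comes for free from
preservation of the inner product. If left multiplications and group elements move both families by
the same change of index, the isometry intertwines them on generators, hence everywhere by
continuity. So each basic isomorphism needs only computations with simple tensors, and no map out of
a completed tensor product has to be built by hand.

An equivariant representation is the same data as a compatible action on the bimodule it defines, so
the statement about representations is the bijection on isomorphism classes of actions read in other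
words. -/

namespace CStarMorita

open MulOpposite

/-! ### Unitaries of Hilbert modules from equal Gram matrices. -/

namespace HilbertModule

variable {B : Type u} [CStarAlgebra B] [PartialOrder B] [StarOrderedRing B]
  {X Y : HilbertModule.{u, w} B}

/-- Two families with dense spans and the same Gram matrix are related by a unitary. -/
lemma exists_unitary {ι : Type*} (j : ι → X) (k : ι → Y)
    (hj : Dense (Submodule.span ℂ (Set.range j) : Set X))
    (hk : Dense (Submodule.span ℂ (Set.range k) : Set Y))
    (h : ∀ i i', X.inner (j i) (j i') = Y.inner (k i) (k i')) :
    ∃ φ : X ≃ₗᵢ[ℂ] Y, (∀ i, φ (j i) = k i) ∧ ∀ x y, Y.inner (φ x) (φ y) = X.inner x y := by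
  let J : (ι →₀ ℂ) →ₗ[ℂ] X := Finsupp.linearCombination ℂ j
  let K : (ι →₀ ℂ) →ₗ[ℂ] Y := Finsupp.linearCombination ℂ k
  have hJ : DenseRange J := by
    rwa [← Finsupp.range_linearCombination, LinearMap.coe_range] at hj
  have hK : DenseRange K := by
    rwa [← Finsupp.range_linearCombination, LinearMap.coe_range] at hk
  -- Equality of the Gram matrices spreads to all finite combinations by linearity in the second
  -- variable, then conjugate linearity in the first.
  have hin : ∀ s t, Y.pre.inner (K s) (K t) = X.pre.inner (J s) (J t) := by
    intro s t
    have h1 : ∀ i, Y.pre.inner (k i) ∘ₗ K = X.pre.inner (j i) ∘ₗ J := fun i => by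
      ext i'
      simpa [J, K] using (h i i').symm
    have h2 : (Y.pre.inner.flip (K t)) ∘ₛₗ K = (X.pre.inner.flip (J t)) ∘ₛₗ J := by
      ext i
      simpa [J, K] using LinearMap.congr_fun (h1 i) t
    exact LinearMap.congr_fun h2 s
  have hn : ∀ s, ‖K (LinearEquiv.refl ℂ _ s)‖ = ‖J s‖ := fun s => by
    rw [LinearEquiv.refl_apply, X.isNorm, Y.isNorm, hin]
  -- `J` and `K` start from the same free space and satisfy `‖K s‖ = ‖J s‖`, so they have the same
  -- kernel and `J s ↦ K s` is a well defined isometry between dense subspaces. Completeness of both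
  -- modules extends it to a bijection.
  let φ := (LinearEquiv.refl ℂ (ι →₀ ℂ)).extendOfIsometry J K hJ hK hn
  have hφ : ∀ s, φ (J s) = K s := fun s =>
    LinearEquiv.extendOfIsometry_eq _ _ _ hJ hK hn s
  refine ⟨φ, fun i => ?_, fun x y => ?_⟩
  · simpa [J, K] using hφ (Finsupp.single i 1)
  · refine hJ.induction_on₂ (p := fun x y => Y.inner (φ x) (φ y) = X.inner x y) ?_ ?_ x y
    · exact isClosed_eq
        ((PreHilbertModule.continuous_inner Y.isNorm).comp
          (φ.continuous.prodMap φ.continuous))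
        (PreHilbertModule.continuous_inner X.isNorm)
    · intro s t
      rw [hφ, hφ]
      exact hin s t

/-- A vector is determined by its inner products, and by surjectivity it is enough to pair with
vectors `φ z`. Both sides then give `⟨z, x⟩ b`, so right linearity need not be checked for the
isometries built from Gram data. -/
lemma map_rsmul_of_inner_map (φ : X ≃ₗ[ℂ] Y) (h : ∀ x y, Y.inner (φ x) (φ y) = X.inner x y)
    (x : X) (b : B) : φ (X.rsmul x b) = Y.rsmul (φ x) b := by
  refine Y.ext_inner fun z => ?_
  obtain ⟨z, rfl⟩ := φ.surjective z
  rw [h]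
  refine (X.pre.inner_rsmul z x b).trans (Eq.trans ?_ (Y.pre.inner_rsmul _ _ b).symm)
  exact congrArg (· * b) (h z x).symm

end HilbertModule

namespace HilbertBimodule

/-! ### Total families in internal tensor products. -/

section Dense

variable {A B C : Type u} [CStarAlgebra A] [CStarAlgebra B] [PartialOrder B] [StarOrderedRing B]
  [CStarAlgebra C] [PartialOrder C] [StarOrderedRing C]
  (X : HilbertBimodule.{u, w} A B) (Y : HilbertBimodule.{u, w} B C)

/-- The left action as a bounded operator. -/
noncomputable def lsmulL (a : A) : X →L[ℂ] X := ⟨X.rep.lsmul a, X.continuous_lsmul a⟩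

/-- The square of the left side is `‖⟨y, ⟨x, x⟩ · y⟩‖`, which Cauchy–Schwarz and the contractivity
of the left action bound by `‖y‖ ‖⟨x, x⟩‖ ‖y‖`. This gives the continuity of simple tensors needed
for density arguments. -/
lemma norm_tmul_le (x : X) (y : Y) : ‖X.tmul Y x y‖ ≤ ‖x‖ * ‖y‖ := by
  refine le_of_sq_le_sq ?_ (by positivity)
  rw [HilbertModule.norm_sq, inner_tmul]
  have h1 := Y.pre.norm_inner_le y (Y.lsmul (X.inner x x) y)
  have h2 := Y.pre.nrm_lsmul_le Y.rep (X.inner x x) y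
  have h3 : Y.pre.nrm y = ‖y‖ := (Y.isNorm y).symm
  rw [← X.norm_sq, h3] at h2
  rw [h3] at h1
  refine h1.trans ?_
  calc _ ≤ ‖y‖ * (‖x‖ ^ 2 * ‖y‖) := mul_le_mul_of_nonneg_left h2 (norm_nonneg _)
    _ = _ := by ring

/-- The simple tensor `x ⊗ y` as a bounded bilinear map. -/
noncomputable def tmulL : X →L[ℂ] Y →L[ℂ] X.tensor Y :=
  LinearMap.mkContinuous₂ ((TensorProduct.mk ℂ X Y).compr₂ (X.ofTensor Y)) 1 fun x y => by
    rw [one_mul]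
    exact X.norm_tmul_le Y x y

variable {X Y}

lemma dense_span_tmul :
    Dense (Submodule.span ℂ (Set.range fun p : X × Y => X.tmul Y p.1 p.2) : Set (X.tensor Y)) := by
  have h : (Set.range fun p : X × Y => X.tmul Y p.1 p.2) =
      X.ofTensor Y '' {t | ∃ x y, x ⊗ₜ[ℂ] y = t} := by
    ext t
    constructor
    · rintro ⟨⟨x, y⟩, rfl⟩
      exact ⟨_, ⟨x, y, rfl⟩, rfl⟩
    · rintro ⟨_, ⟨x, y, rfl⟩, rfl⟩
      exact ⟨(x, y), rfl⟩
  rw [h, Submodule.span_image, TensorProduct.span_tmul_eq_top, Submodule.map_top,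
    LinearMap.coe_range]
  exact denseRange_ofTensor

/-- The closed span of the given tensors absorbs all simple tensors one factor at a time: for a
fixed vector in one slot, the vectors allowed in the other slot form a closed subspace containing a
total family. -/
lemma dense_span_tmul_of_dense {ι κ : Type*} {f : ι → X} {k : κ → Y}
    (hf : Dense (Submodule.span ℂ (Set.range f) : Set X))
    (hk : Dense (Submodule.span ℂ (Set.range k) : Set Y)) :
    Dense (Submodule.span ℂ (Set.range fun p : ι × κ => X.tmul Y (f p.1) (k p.2)) :
      Set (X.tensor Y)) := by
  set K := (Submodule.span ℂ
    (Set.range fun p : ι × κ => X.tmul Y (f p.1) (k p.2))).topologicalClosure with hK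
  have hKc : IsClosed (K : Set (X.tensor Y)) := Submodule.isClosed_topologicalClosure _
  have h1 : ∀ i y, X.tmul Y (f i) y ∈ K := by
    intro i
    have hle : Submodule.span ℂ (Set.range k) ≤ K.comap (X.tmulL Y (f i)).toLinearMap := by
      rw [Submodule.span_le]
      rintro _ ⟨l, rfl⟩
      exact Submodule.le_topologicalClosure _ (Submodule.subset_span ⟨(i, l), rfl⟩)
    have hc := closure_minimal hle (hKc.preimage (X.tmulL Y (f i)).continuous)
    rw [hk.closure_eq] at hc
    exact fun y => hc (Set.mem_univ y)
  have h2 : ∀ x y, X.tmul Y x y ∈ K := by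
    intro x y
    have hle : Submodule.span ℂ (Set.range f) ≤ K.comap ((X.tmulL Y).flip y).toLinearMap := by
      rw [Submodule.span_le]
      rintro _ ⟨i, rfl⟩
      exact h1 i y
    have hc := closure_minimal hle (hKc.preimage ((X.tmulL Y).flip y).continuous)
    rw [hf.closure_eq] at hc
    exact hc (Set.mem_univ x)
  -- `K` is its own closure, so the claim becomes density of `K`, which follows once `K` contains
  -- every simple tensor.
  rw [Submodule.dense_iff_topologicalClosure_eq_top, ← hK, ← hKc.submodule_topologicalClosure_eq,
    ← Submodule.dense_iff_topologicalClosure_eq_top]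
  refine dense_span_tmul.mono (Submodule.span_le.2 ?_)
  rintro _ ⟨⟨x, y⟩, rfl⟩
  exact h2 x y

lemma dense_span_id (X : HilbertBimodule.{u, w} A B) :
    Dense (Submodule.span ℂ (Set.range (id : X → X)) : Set X) := by
  simp

end Dense

/-! ### The two bracketings of a triple tensor product. -/

section Assoc

variable {A B C D : Type u} [CStarAlgebra A] [CStarAlgebra B] [PartialOrder B] [StarOrderedRing B]
  [CStarAlgebra C] [PartialOrder C] [StarOrderedRing C]
  [CStarAlgebra D] [PartialOrder D] [StarOrderedRing D]
  (X : HilbertBimodule.{u, w} A B) (Y : HilbertBimodule.{u, w} B C)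
  (Z : HilbertBimodule.{u, w} C D)

lemma dense_span_tmul_tmul :
    Dense (Submodule.span ℂ (Set.range fun i : (X × Y) × Z =>
      (X.tensor Y).tmul Z (X.tmul Y i.1.1 i.1.2) i.2) : Set ((X.tensor Y).tensor Z)) :=
  dense_span_tmul_of_dense (f := fun i : X × Y => X.tmul Y i.1 i.2) (k := fun z : Z => z)
    dense_span_tmul (dense_span_id Z)

/-- The index set is bracketed as `(X × Y) × Z` here too, so that both triple products carry
families over literally the same index type. -/
lemma dense_span_tmul_tmul' :
    Dense (Submodule.span ℂ (Set.range fun i : (X × Y) × Z =>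
      X.tmul (Y.tensor Z) i.1.1 (Y.tmul Z i.1.2 i.2)) : Set (X.tensor (Y.tensor Z))) := by
  have h := dense_span_tmul_of_dense (f := fun x : X => x)
    (k := fun i : Y × Z => Y.tmul Z i.1 i.2) (dense_span_id X) dense_span_tmul
  refine h.mono (Submodule.span_mono ?_)
  rintro _ ⟨⟨x, y, z⟩, rfl⟩
  exact ⟨((x, y), z), rfl⟩

/-- Both sides unfold to `⟨z, ⟨y, ⟨x, x'⟩ · y'⟩ · z'⟩`. -/
lemma inner_tmul_tmul (x x' : X) (y y' : Y) (z z' : Z) :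
    ((X.tensor Y).tensor Z).inner ((X.tensor Y).tmul Z (X.tmul Y x y) z)
        ((X.tensor Y).tmul Z (X.tmul Y x' y') z') =
      (X.tensor (Y.tensor Z)).inner (X.tmul (Y.tensor Z) x (Y.tmul Z y z))
        (X.tmul (Y.tensor Z) x' (Y.tmul Z y' z')) := by
  rw [inner_tmul, inner_tmul, inner_tmul, lsmul_tmul, inner_tmul]

end Assoc

end HilbertBimodule

/-! ### A density criterion for equivariant isomorphism. -/

namespace CompatibleBimodule

open HilbertBimodule

section

variable {A B : Type u} {G : Type v} [Group G] [CStarAlgebra A]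
  [CStarAlgebra B] [PartialOrder B] [StarOrderedRing B]
  {S : TwistedSystem A G} {T : TwistedSystem B G}

/-- Two families with dense spans, the same Gram matrix, and on which the left actions and the
group actions agree. -/
lemma EquivIso.of_dense {P Q : CompatibleBimodule.{u, v, w} S T} {ι : Type*} (j : ι → P.mod)
    (k : ι → Q.mod) (hj : Dense (Submodule.span ℂ (Set.range j) : Set P.mod))
    (hk : Dense (Submodule.span ℂ (Set.range k) : Set Q.mod))
    (h : ∀ i i', P.mod.inner (j i) (j i') = Q.mod.inner (k i) (k i'))
    (hl : ∀ a i, ∃ i', P.mod.lsmul a (j i) = j i' ∧ Q.mod.lsmul a (k i) = k i')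
    (hg : ∀ g i, ∃ i', P.act g (j i) = j i' ∧ Q.act g (k i) = k i') : EquivIso P Q := by
  obtain ⟨φ, hφ, hin⟩ := HilbertModule.exists_unitary j k hj hk h
  let Φ : P.mod →L[ℂ] Q.mod := φ.toContinuousLinearEquiv
  -- One argument serves both the left actions and the group actions: bounded operators that move
  -- the two families by the same change of index are intertwined by `φ` on a total set, hence
  -- everywhere.
  have key : ∀ (f : P.mod →L[ℂ] P.mod) (f' : Q.mod →L[ℂ] Q.mod),
      (∀ i, ∃ i', f (j i) = j i' ∧ f' (k i) = k i') → ∀ x, φ (f x) = f' (φ x) := by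
    intro f f' hf x
    have : Φ ∘L f = f' ∘L Φ := by
      refine ContinuousLinearMap.ext_on hj ?_
      rintro _ ⟨i, rfl⟩
      obtain ⟨i', h1, h2⟩ := hf i
      change φ (f (j i)) = f' (φ (j i))
      rw [h1, hφ, hφ, h2]
    exact DFunLike.congr_fun this x
  exact ⟨⟨φ.toLinearEquiv, fun a => key (P.mod.lsmulL a) (Q.mod.lsmulL a) (hl a),
    HilbertModule.map_rsmul_of_inner_map φ.toLinearEquiv hin, hin⟩,
    fun g => key (P.act g) (Q.act g) (hg g)⟩

end

/-! ### Associativity of the product of compatible actions. -/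

section Assoc

variable {A B C D : Type u} {G : Type v} [Group G] [CStarAlgebra A]
  [CStarAlgebra B] [PartialOrder B] [StarOrderedRing B]
  [CStarAlgebra C] [PartialOrder C] [StarOrderedRing C]
  [CStarAlgebra D] [PartialOrder D] [StarOrderedRing D]
  {S : TwistedSystem A G} {T : TwistedSystem B G} {U : TwistedSystem C G} {V : TwistedSystem D G}

lemma tensor_act_tmul (P : CompatibleBimodule.{u, v, w} S T) (Q : CompatibleBimodule.{u, v, w} T U)
    (g : G) (x : P.mod) (y : Q.mod) :
    (P.tensor Q).act g (P.tmul Q x y) = P.tmul Q (P.act g x) (Q.act g y) :=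
  P.compat.tensorAct_tmul Q.compat g x y

/-- The isomorphism is `(x ⊗ y) ⊗ z ↦ x ⊗ (y ⊗ z)`. An element `a` acts on the index by replacing
`x` with `a · x`, and `g` acts on the three entries simultaneously. -/
lemma EquivIso.assoc (P : CompatibleBimodule.{u, v, w} S T) (Q : CompatibleBimodule.{u, v, w} T U)
    (R : CompatibleBimodule.{u, v, w} U V) :
    EquivIso ((P.tensor Q).tensor R) (P.tensor (Q.tensor R)) := by
  refine EquivIso.of_dense (ι := (P.mod × Q.mod) × R.mod)
    (fun i => (P.tensor Q).tmul R (P.tmul Q i.1.1 i.1.2) i.2)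
    (fun i => P.tmul (Q.tensor R) i.1.1 (Q.tmul R i.1.2 i.2)) ?_ ?_ ?_ ?_ ?_
  · exact dense_span_tmul_tmul P.mod Q.mod R.mod
  · exact dense_span_tmul_tmul' P.mod Q.mod R.mod
  · rintro ⟨⟨x, y⟩, z⟩ ⟨⟨x', y'⟩, z'⟩
    exact inner_tmul_tmul P.mod Q.mod R.mod x x' y y' z z'
  · rintro a ⟨⟨x, y⟩, z⟩
    refine ⟨((P.mod.lsmul a x, y), z), ?_, lsmul_tmul (Y := Q.mod.tensor R.mod) _ _ _⟩
    refine (lsmul_tmul (X := P.mod.tensor Q.mod) _ _ _).trans ?_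
    exact congrArg ((P.tensor Q).tmul R · z) (lsmul_tmul _ _ _)
  · rintro g ⟨⟨x, y⟩, z⟩
    refine ⟨((P.act g x, Q.act g y), R.act g z), ?_, ?_⟩
    · refine (tensor_act_tmul (P.tensor Q) R g _ _).trans ?_
      exact congrArg ((P.tensor Q).tmul R · _) (tensor_act_tmul P Q g x y)
    · refine (tensor_act_tmul P (Q.tensor R) g _ _).trans ?_
      exact congrArg (P.tmul (Q.tensor R) _) (tensor_act_tmul Q R g y z)

end Assoc

/-! ### The systems themselves as units. -/

section Unit

variable {A B : Type u} {G : Type v} [Group G]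
  [CStarAlgebra A] [PartialOrder A] [StarOrderedRing A]
  [CStarAlgebra B] [PartialOrder B] [StarOrderedRing B]
  {S : TwistedSystem A G} {T : TwistedSystem B G}

/-- The isomorphism is `a ⊗ x ↦ a · x`; already the tensors `1 ⊗ x` make its image everything. The
Gram matrices agree because `⟨a · x, a' · x'⟩ = ⟨x, a⋆ a' · x'⟩`. The bimodule lives in the universe
of `A` because the unit bimodule does. -/
lemma EquivIso.one_tensor (P : CompatibleBimodule.{u, v, u} S T) :
    EquivIso ((one S).tensor P) P := by
  refine EquivIso.of_dense (ι := A × P.mod) (fun i => (one S).tmul P i.1 i.2)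
    (fun i => P.mod.lsmul i.1 i.2) dense_span_tmul ?_ ?_ ?_ ?_
  · refine (dense_span_id P.mod).mono (Submodule.span_mono ?_)
    rintro _ ⟨x, rfl⟩
    exact ⟨(1, x), lsmul_one x⟩
  · rintro ⟨a, x⟩ ⟨a', x'⟩
    refine (inner_tmul (X := HilbertBimodule.self A) _ _ _ _).trans ?_
    refine Eq.trans ?_ (P.mod.rep.inner_lsmul a x _).symm
    exact congrArg (P.mod.inner x) (lsmul_lsmul x' (star a) a').symm
  · rintro a ⟨b, x⟩
    exact ⟨(a * b, x), lsmul_tmul (X := HilbertBimodule.self A) _ _ _, lsmul_lsmul _ _ _⟩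
  · rintro g ⟨a, x⟩
    exact ⟨(S.α g a, P.act g x), tensor_act_tmul (one S) P g a x, P.compat.map_lsmul g a x⟩

/-- The isomorphism is `x ⊗ b ↦ x · b`, with Gram matrix entries `b⋆ ⟨x, x'⟩ b'` on both sides. -/
lemma EquivIso.tensor_one (P : CompatibleBimodule.{u, v, u} S T) :
    EquivIso (P.tensor (one T)) P := by
  refine EquivIso.of_dense (ι := P.mod × B) (fun i => P.tmul (one T) i.1 i.2)
    (fun i => P.mod.rsmul i.1 i.2) dense_span_tmul ?_ ?_ ?_ ?_
  · refine (dense_span_id P.mod).mono (Submodule.span_mono ?_)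
    rintro _ ⟨x, rfl⟩
    exact ⟨(x, 1), rsmul_one x⟩
  · rintro ⟨x, b⟩ ⟨x', b'⟩
    refine (inner_tmul (Y := HilbertBimodule.self B) _ _ _ _).trans ?_
    refine Eq.trans ?_ (P.mod.pre.inner_rsmul _ x' b').symm
    refine Eq.trans ?_ (congrArg (· * b') (P.mod.pre.inner_rsmul_left x x' b)).symm
    exact (mul_assoc (star b) (P.mod.inner x x') b').symm
  · rintro a ⟨x, b⟩
    exact ⟨(P.mod.lsmul a x, b), lsmul_tmul (Y := HilbertBimodule.self B) _ _ _,
      lsmul_rsmul _ _ _ _⟩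
  · rintro g ⟨x, b⟩
    exact ⟨(P.act g x, T.α g b), tensor_act_tmul P (one T) g x b, P.compat.map_rsmul g x b⟩

end Unit

end CompatibleBimodule

/-! ### The conjugate bimodule as a tensor inverse. -/

namespace SystemMoritaEquivalence

open HilbertBimodule CompatibleBimodule

variable {A B : Type u} {G : Type v} [Group G]
  [CStarAlgebra A] [PartialOrder A] [StarOrderedRing A]
  [CStarAlgebra B] [PartialOrder B] [StarOrderedRing B]
  {S : TwistedSystem A G} {T : TwistedSystem B G} (M : SystemMoritaEquivalence.{u, v, u} S T)

/-- `Z̃ ⊗_A Z ≅ B` through `z̃ ⊗ z' ↦ ⟨z, z'⟩_B`. -/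
lemma equivIso_conjugate_tensor :
    EquivIso (M.conjugate.tensor M.toCompatibleBimodule) (one T) := by
  refine EquivIso.of_dense (ι := M.bimod × M.bimod)
    (fun i => M.conjugate.tmul M.toCompatibleBimodule (M.tilde i.1) i.2)
    (fun i => M.bimod.inner i.1 i.2) ?_ ?_ ?_ ?_ ?_
  · exact dense_span_tmul (X := M.conjugate.mod) (Y := M.toCompatibleBimodule.mod)
  -- Fullness on the right is exactly what makes the isometry onto `B` surjective.
  · refine M.bimod.full_right.mono (Submodule.span_mono ?_)
    rintro _ ⟨x, y, rfl⟩
    exact ⟨(x, y), rfl⟩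
  · rintro ⟨z, z'⟩ ⟨w, w'⟩
    refine (inner_tmul (X := M.conjugate.mod) (Y := M.toCompatibleBimodule.mod) _ _ _ _).trans ?_
    -- The linking identity turns `_A⟨z, w⟩ · w'` into `z · ⟨w, w'⟩`, so the Gram entry is `⟨z', z⟩
    -- ⟨w, w'⟩ = ⟨z, z'⟩⋆ ⟨w, w'⟩`.
    refine (congrArg (M.bimod.pre.inner z') (M.bimod.leftInner_smul_eq z w w')).trans ?_
    refine (M.bimod.pre.inner_rsmul z' z _).trans ?_
    exact congrArg (· * M.bimod.inner w w') (M.bimod.pre.star_inner z z').symm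
  · rintro b ⟨z, z'⟩
    -- Since `b · z̃ = (z · b⋆)~`, the index moves by `b⋆`; conjugate linearity on the other side
    -- returns `⟨z · b⋆, z'⟩ = b ⟨z, z'⟩`.
    refine ⟨(M.bimod.rsmul z (star b), z'),
      lsmul_tmul (X := M.conjugate.mod) (Y := M.toCompatibleBimodule.mod) _ _ _, ?_⟩
    refine Eq.trans ?_ (M.bimod.pre.inner_rsmul_left z z' (star b)).symm
    rw [star_star]
    rfl
  · rintro g ⟨z, z'⟩
    exact ⟨(M.act g z, M.act g z'), tensor_act_tmul M.conjugate M.toCompatibleBimodule g _ _,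
      (M.compat.inner_map g z z').symm⟩

/-- `Z ⊗_B Z̃ ≅ A` through `z ⊗ z̃' ↦ _A⟨z, z'⟩`. -/
lemma equivIso_tensor_conjugate :
    EquivIso (M.toCompatibleBimodule.tensor M.conjugate) (one S) := by
  refine EquivIso.of_dense (ι := M.bimod × M.bimod)
    (fun i => M.toCompatibleBimodule.tmul M.conjugate i.1 (M.tilde i.2))
    (fun i => M.bimod.leftInner i.1 i.2) ?_ ?_ ?_ ?_ ?_
  · exact dense_span_tmul (X := M.toCompatibleBimodule.mod) (Y := M.conjugate.mod)
  · refine M.bimod.full_left.mono (Submodule.span_mono ?_)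
    rintro _ ⟨x, y, rfl⟩
    exact ⟨(x, y), rfl⟩
  · rintro ⟨z, w⟩ ⟨z', w'⟩
    refine (inner_tmul (X := M.toCompatibleBimodule.mod) (Y := M.conjugate.mod) _ _ _ _).trans ?_
    change M.bimod.leftInner w (M.bimod.pre.rsmul (op (star (M.bimod.inner z z'))) w') =
      star (M.bimod.leftInner z w) * M.bimod.leftInner z' w'
    -- Both sides become `_A⟨w · ⟨z, z'⟩, w'⟩`: on the left by moving `⟨z, z'⟩⋆` across the
    -- `A`-valued inner product, on the right by the linking identity `_A⟨w, z⟩ · z' = w · ⟨z, z'⟩`.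
    rw [← M.bimod.leftInner_rsmul, M.bimod.star_leftInner, ← M.bimod.leftInner_lsmul,
      M.bimod.leftInner_smul_eq]
  · rintro a ⟨z, w⟩
    exact ⟨(M.bimod.lsmul a z, w),
      lsmul_tmul (X := M.toCompatibleBimodule.mod) (Y := M.conjugate.mod) _ _ _,
      (M.bimod.leftInner_lsmul a z w).symm⟩
  · rintro g ⟨z, w⟩
    -- Compatibility only prescribes how `δ` transforms the `B`-valued inner product; for the
    -- `A`-valued one this is `leftInner_act`, a consequence of left fullness.
    exact ⟨(M.act g z, M.act g w), tensor_act_tmul M.toCompatibleBimodule M.conjugate g _ _,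
      (M.leftInner_act g z w).symm⟩

/-- This and the next three lemmas are the cancellation rules for an invertible arrow: rebracket,
replace the adjacent pair of `Z` and `Z̃` by the unit, and absorb the unit. -/
lemma tensor_conjugate_tensor (P : CompatibleBimodule.{u, v, u} S S) :
    EquivIso (M.toCompatibleBimodule.tensor (M.conjugate.tensor P)) P :=
  (EquivIso.assoc _ _ _).symm.trans
    ((M.equivIso_tensor_conjugate.tensor (.refl P)).trans (.one_tensor P))

lemma conjugate_tensor_tensor (Q : CompatibleBimodule.{u, v, u} T S) :
    EquivIso (M.conjugate.tensor (M.toCompatibleBimodule.tensor Q)) Q :=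
  (EquivIso.assoc _ _ _).symm.trans
    ((M.equivIso_conjugate_tensor.tensor (.refl Q)).trans (.one_tensor Q))

lemma tensor_tensor_conjugate (Q : CompatibleBimodule.{u, v, u} T S) :
    EquivIso ((Q.tensor M.toCompatibleBimodule).tensor M.conjugate) Q :=
  (EquivIso.assoc _ _ _).trans
    (((EquivIso.refl Q).tensor M.equivIso_tensor_conjugate).trans (.tensor_one Q))

lemma tensor_conjugate_tensor' (Q : CompatibleBimodule.{u, v, u} T T) :
    EquivIso ((Q.tensor M.conjugate).tensor M.toCompatibleBimodule) Q :=
  (EquivIso.assoc _ _ _).trans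
    (((EquivIso.refl Q).tensor M.equivIso_conjugate_tensor).trans (.tensor_one Q))

end SystemMoritaEquivalence

/-! ### Conjugation by the Morita equivalence. -/

namespace SystemMoritaEquivalence

open HilbertBimodule CompatibleBimodule

variable {A B : Type u} {G : Type v} [Group G]
  [CStarAlgebra A] [PartialOrder A] [StarOrderedRing A]
  [CStarAlgebra B] [PartialOrder B] [StarOrderedRing B]
  {S : TwistedSystem A G} {T : TwistedSystem B G} (M : SystemMoritaEquivalence.{u, v, u} S T)

/-- The pair `(Y, w)` with `Y = (Z̃ ⊗ X) ⊗ Z` and `w = (δ̃ ⊗ v) ⊗ δ`. -/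
noncomputable def transfer (P : CompatibleBimodule.{u, v, u} S S) :
    CompatibleBimodule.{u, v, u} T T :=
  (M.conjugate.tensor P).tensor M.toCompatibleBimodule

/-- The pair `(Z ⊗ (Y ⊗ Z̃), δ ⊗ (w ⊗ δ̃))`. -/
noncomputable def transferBack (Q : CompatibleBimodule.{u, v, u} T T) :
    CompatibleBimodule.{u, v, u} S S :=
  M.toCompatibleBimodule.tensor (Q.tensor M.conjugate)

lemma transfer_congr {P P' : CompatibleBimodule.{u, v, u} S S} (h : EquivIso P P') :
    EquivIso (M.transfer P) (M.transfer P') :=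
  ((EquivIso.refl _).tensor h).tensor (.refl _)

lemma transferBack_congr {Q Q' : CompatibleBimodule.{u, v, u} T T} (h : EquivIso Q Q') :
    EquivIso (M.transferBack Q) (M.transferBack Q') :=
  (EquivIso.refl _).tensor (h.tensor (.refl _))

/-- In `Z ⊗ (((Z̃ ⊗ X) ⊗ Z) ⊗ Z̃)` the right-hand pair `Z`, `Z̃` cancels first, then the left-hand
pair. -/
lemma transferBack_transfer (P : CompatibleBimodule.{u, v, u} S S) :
    EquivIso (M.transferBack (M.transfer P)) P :=
  ((EquivIso.refl _).tensor (M.tensor_tensor_conjugate (M.conjugate.tensor P))).trans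
    (M.tensor_conjugate_tensor P)

lemma transfer_transferBack (Q : CompatibleBimodule.{u, v, u} T T) :
    EquivIso (M.transfer (M.transferBack Q)) Q :=
  ((M.conjugate_tensor_tensor (Q.tensor M.conjugate)).tensor (.refl _)).trans
    (M.tensor_conjugate_tensor' Q)

/-- As for `(z⁻¹ p z)(z⁻¹ q z) = z⁻¹ p q z`, the inner pair `Z ⊗ Z̃` disappears. Both sides are
compared with `(Z̃ ⊗ P) ⊗ (Q ⊗ Z)`. -/
lemma transfer_tensor (P Q : CompatibleBimodule.{u, v, u} S S) :
    EquivIso (M.transfer (P.tensor Q)) ((M.transfer P).tensor (M.transfer Q)) := by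
  have h : EquivIso (M.toCompatibleBimodule.tensor (M.transfer Q))
      (Q.tensor M.toCompatibleBimodule) :=
    (EquivIso.assoc _ _ _).symm.trans ((M.tensor_conjugate_tensor Q).tensor (.refl _))
  -- The chain is built backwards from the product of the two transfers: rebracket to expose `Z ⊗
  -- transfer Q`, replace it by `Q ⊗ Z` through `h`, then rebracket.
  refine .trans ?_ (EquivIso.assoc (M.conjugate.tensor P) M.toCompatibleBimodule
    (M.transfer Q)).symm
  refine .trans ?_ ((EquivIso.refl (M.conjugate.tensor P)).tensor h).symm
  refine .trans ?_ (EquivIso.assoc _ _ _)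
  exact (EquivIso.assoc _ _ _).symm.tensor (.refl _)

/-- `(Z̃ ⊗ A) ⊗ Z ≅ Z̃ ⊗ Z ≅ B`. -/
lemma transfer_one : EquivIso (M.transfer (one S)) (one T) :=
  ((EquivIso.tensor_one M.conjugate).tensor (.refl _)).trans M.equivIso_conjugate_tensor

lemma equivIso_of_transfer {P P' : CompatibleBimodule.{u, v, u} S S}
    (h : EquivIso (M.transfer P) (M.transfer P')) : EquivIso P P' :=
  (M.transferBack_transfer P).symm.trans
    ((M.transferBack_congr h).trans (M.transferBack_transfer P'))

end SystemMoritaEquivalence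

/-! ### The induced bijection of classes of compatible actions. -/

namespace ActionClass

open CompatibleBimodule

variable {A B : Type u} {G : Type v} [Group G]
  [CStarAlgebra A] [PartialOrder A] [StarOrderedRing A]
  [CStarAlgebra B] [PartialOrder B] [StarOrderedRing B]
  {S : TwistedSystem A G} {T : TwistedSystem B G}

protected lemma mul_assoc (a b c : ActionClass.{u, v, u} S) : a * b * c = a * (b * c) := by
  induction a using Quotient.inductionOn
  induction b using Quotient.inductionOn
  induction c using Quotient.inductionOn
  exact Quotient.sound (EquivIso.assoc _ _ _)

protected lemma one_mul (a : ActionClass.{u, v, u} S) : 1 * a = a := by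
  induction a using Quotient.inductionOn
  exact Quotient.sound (EquivIso.one_tensor _)

protected lemma mul_one (a : ActionClass.{u, v, u} S) : a * 1 = a := by
  induction a using Quotient.inductionOn
  exact Quotient.sound (EquivIso.tensor_one _)

/-- The map `[X, v] ↦ [Y, w]`. -/
noncomputable def transfer (M : SystemMoritaEquivalence.{u, v, u} S T) :
    ActionClass.{u, v, u} S → ActionClass.{u, v, u} T :=
  Quotient.map M.transfer fun _ _ h => M.transfer_congr h

lemma transfer_bijective (M : SystemMoritaEquivalence.{u, v, u} S T) :
    Function.Bijective (transfer M) := by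
  constructor
  · intro a b h
    induction a using Quotient.inductionOn
    induction b using Quotient.inductionOn
    exact Quotient.sound (M.equivIso_of_transfer (Quotient.exact h))
  · intro b
    induction b using Quotient.inductionOn with
    | _ Q => exact ⟨mk (M.transferBack Q), Quotient.sound (M.transfer_transferBack Q)⟩

lemma transfer_mul (M : SystemMoritaEquivalence.{u, v, u} S T) (a b : ActionClass.{u, v, u} S) :
    transfer M (a * b) = transfer M a * transfer M b := by
  induction a using Quotient.inductionOn
  induction b using Quotient.inductionOn
  exact Quotient.sound (M.transfer_tensor _ _)

lemma transfer_one (M : SystemMoritaEquivalence.{u, v, u} S T) : transfer M 1 = 1 :=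
  Quotient.sound M.transfer_one

end ActionClass

/-! ### The induced bijection of classes of equivariant representations. -/

namespace EquivariantRepClass

open CompatibleBimodule EquivariantRep

variable {A B : Type u} {G : Type v} [Group G]
  [CStarAlgebra A] [PartialOrder A] [StarOrderedRing A]
  [CStarAlgebra B] [PartialOrder B] [StarOrderedRing B]
  {S : TwistedSystem A G} {T : TwistedSystem B G}

/-- The map induced by `(ρ, v) ↦ (τ, w)` on isomorphism classes. -/
noncomputable def transfer (M : SystemMoritaEquivalence.{u, v, u} S T) :
    EquivariantRepClass.{u, v, u} S → EquivariantRepClass.{u, v, u} T :=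
  Quotient.map (fun R => ofCompatibleBimodule (M.transfer R.toCompatibleBimodule))
    fun R R' h => (isoRel_iff _ _).2 (M.transfer_congr ((isoRel_iff R R').1 h))

/-- Passing from a compatible action to a representation and back returns the same data
definitionally, so `isoRel_iff` carries over both halves of the argument for compatible actions. -/
lemma transfer_bijective (M : SystemMoritaEquivalence.{u, v, u} S T) :
    Function.Bijective (transfer M) := by
  constructor
  · intro a b h
    induction a using Quotient.inductionOn
    induction b using Quotient.inductionOn
    exact Quotient.sound ((isoRel_iff _ _).2
      (M.equivIso_of_transfer ((isoRel_iff _ _).1 (Quotient.exact h))))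
  · intro b
    induction b using Quotient.inductionOn with
    | _ R =>
      exact ⟨mk (ofCompatibleBimodule (M.transferBack R.toCompatibleBimodule)),
        Quotient.sound ((isoRel_iff _ _).2 (M.transfer_transferBack R.toCompatibleBimodule))⟩

end EquivariantRepClass

end CStarMorita

theorem mainTheorem5 {A B : Type u} {G : Type v} [Group G]
    [CStarAlgebra A] [PartialOrder A] [StarOrderedRing A]
    [CStarAlgebra B] [PartialOrder B] [StarOrderedRing B]
    (S : TwistedSystem A G) (T : TwistedSystem B G) (M : SystemMoritaEquivalence.{u, v, u} S T) :
    -- `w = (δ̃ ⊗ v) ⊗ δ` is a compatible action on `Y = (Z̃ ⊗ X) ⊗ Z`, acting as expected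
    (∀ P : CompatibleBimodule.{u, v, u} S S,
      IsCompatibleAction T T
        ((M.conjugate.tensor P).tensor M.toCompatibleBimodule).mod
        ((M.conjugate.tensor P).tensor M.toCompatibleBimodule).act ∧
      ∀ (g : G) (z : M.bimod) (x : P.mod) (z' : M.bimod),
        ((M.conjugate.tensor P).tensor M.toCompatibleBimodule).act g
          ((M.conjugate.tensor P).tmul M.toCompatibleBimodule
            (M.conjugate.tmul P (M.tilde z) x) z') =
          (M.conjugate.tensor P).tmul M.toCompatibleBimodule
            (M.conjugate.tmul P (M.tilde (M.act g z)) (P.act g x)) (M.act g z')) ∧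
    -- `δ ⊗ (w ⊗ δ̃)` on `Z ⊗ (Y ⊗ Z̃)` is equivariantly isomorphic to `v`
    (∀ P : CompatibleBimodule.{u, v, u} S S,
      CompatibleBimodule.EquivIso
        (M.toCompatibleBimodule.tensor
          (((M.conjugate.tensor P).tensor M.toCompatibleBimodule).tensor M.conjugate)) P) ∧
    -- `𝒜(Σ)` and `𝒜(Θ)` are monoids
    ((∀ a b c : ActionClass.{u, v, u} S, a * b * c = a * (b * c)) ∧
      ∀ a : ActionClass.{u, v, u} S, 1 * a = a ∧ a * 1 = a) ∧
    ((∀ a b c : ActionClass.{u, v, u} T, a * b * c = a * (b * c)) ∧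
      ∀ a : ActionClass.{u, v, u} T, 1 * a = a ∧ a * 1 = a) ∧
    -- `[X, v] ↦ [Y, w]` is a product preserving bijection `𝒜(Σ) → 𝒜(Θ)`
    (∃ F : ActionClass.{u, v, u} S → ActionClass.{u, v, u} T,
      (∀ P : CompatibleBimodule.{u, v, u} S S,
        F (ActionClass.mk P) =
          ActionClass.mk ((M.conjugate.tensor P).tensor M.toCompatibleBimodule)) ∧
      Function.Bijective F ∧ (∀ a b, F (a * b) = F a * F b) ∧ F 1 = 1) ∧
    -- the same correspondence between isomorphism classes of equivariant representations
    (∃ F : EquivariantRepClass.{u, v, u} S → EquivariantRepClass.{u, v, u} T,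
      (∀ R : EquivariantRep.{u, v, u} S,
        F (EquivariantRepClass.mk R) =
          EquivariantRepClass.mk (EquivariantRep.ofCompatibleBimodule
            ((M.conjugate.tensor R.toCompatibleBimodule).tensor M.toCompatibleBimodule))) ∧
      Function.Bijective F) :=
  ⟨fun P => ⟨((M.conjugate.tensor P).tensor M.toCompatibleBimodule).compat, fun g z x z' =>
      (CompatibleBimodule.tensor_act_tmul (M.conjugate.tensor P) M.toCompatibleBimodule g _ z').trans
        (congrArg ((M.conjugate.tensor P).tmul M.toCompatibleBimodule · (M.act g z'))
          (CompatibleBimodule.tensor_act_tmul M.conjugate P g (M.tilde z) x))⟩,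
    M.transferBack_transfer,
    ⟨ActionClass.mul_assoc, fun a => ⟨a.one_mul, a.mul_one⟩⟩,
    ⟨ActionClass.mul_assoc, fun a => ⟨a.one_mul, a.mul_one⟩⟩,
    -- Well-definedness is contained in `transfer`, which descends to the quotient through
    -- `transfer_congr`; its value on a class is then the required one by definition.
    ⟨ActionClass.transfer M, fun _ => rfl, ActionClass.transfer_bijective M,
      ActionClass.transfer_mul M, ActionClass.transfer_one M⟩,
    ⟨EquivariantRepClass.transfer M, fun _ => rfl, EquivariantRepClass.transfer_bijective M⟩⟩
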